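/- **Model.** For each $p\in\mathbb N$ let $n,s_0,r\in\mathbb N$, $\epsilon>0$, $\delta\in(0,1)$ be functions of $p$. Let $X\in\mathbb R^{n\times p}$ have i.i.d. entries from a fixed law $\mathcal D$ supported on $[-b,b]$ with mean $0$ and variance $1$. Let $y=X\theta_0+\xi$, where $\|\theta_0\|_2=1$, $\theta_0\in\mathbb R^p$ has exactly $s_0$ nonzero entries (for all large $p$), and $\xi_1,\dots,\xi_n$ are i.i.d. $N(0,\sigma^2)$ conditioned on $[-b_n,b_n]$, with $\sigma>0$, $\sigma=\Theta(1)$ (e.g. constant), $b_n=O(\sigma\sqrt{\log n})$ and $b_n/\sigma-\sqrt{2\log(2n)}\to\infty$. Let $R=[R_1\,R_2\,R_3]\in\mathbb R^{r\times(n+p+1)}$ have i.i.d. $N(0,1/r)$ entries, with $X,\xi,R$ independent. Put $$B^2=2pb^2+(b\sqrt{s_0}+b_n)^2,\qquad w^2=\frac{4B^2}{\epsilon}\Big(\sqrt{2r\log(4/\delta)}+\log(4/\delta)\Big),$$ $$[X^*\ y^*]=R\begin{bmatrix}X\ \ y\\ wI_{p+1}\end{bmatrix},\qquad \lambda=C_\lambda\,\sigma\max\Big\{\sqrt{\tfrac{\log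 p}{n}},\sqrt{\tfrac{(\log p)^3}{r}}\Big\},\qquad \widehat\theta^*\in\arg\min_{\theta\in\mathbb R^p}\frac1{2n}\|X^*\theta-y^*\|_2^2+\lambda\|\theta\|_1,$$ $$\rho_n^2=\frac{n+r+1}{nr}+\frac{w^2}{nr},\qquad \phi_w=1+\frac{w^2}{n},\qquad \kappa_n=2\lambda\sqrt{s_0}+\frac{w^2}{n},$$ $$\Delta=\Big(\tfrac1nX^\top X-I_p\Big)(\theta_0-\widehat\theta^*)+\tfrac1n[X^\top\ wI_p\ 0](R^\top R-I_{n+p+1})\begin{bmatrix}X(\theta_0-\widehat\theta^*)\\-w\widehat\theta^*\\w\end{bmatrix}$$ ($\Delta$ is the bias of the debiased private Lasso estimator). **Theorem.** There is an absolute constant $C_\lambda>0$ such that the following holds. Let $\alpha>2$, $\gamma>3/4$, $c_0\in(0,1)$, let $n=p^\alpha$ and $s_0=c_0p$ (each up to rounding by at most $1$), $\epsilon=p^\gamma$, and $\log(1/\delta)=O(\log p)$. Then there is a choice of $r=r(p)\to\infty$, not depending on $\mathcal D,b,\sigma,b_n,\theta_0$, such that in every model as above, as $p\to\infty$, the following four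 conditions hold: 1. $\dfrac{\kappa_n^2}{\lambda^2\phi_w}=o\Big(\sqrt{\tfrac n{\log p}}\,\min\big\{1,\sqrt{\tfrac rn},\tfrac{\sqrt{rn}}{w^2}\big\}\Big)$; 2. $\sqrt{s_0}=O\left(\dfrac{\max\{\frac1{\sqrt n},\frac{\log p}{\sqrt r}\}}{\max\{\frac{w\log p}{\sqrt{nr}},\frac{w^2}{n}\sqrt{\frac{\log p}{r}}\}}\right)$; 3. $\dfrac{\sqrt{s_0}}{\sigma\rho_n}=o\Big(\min\big\{\tfrac n{w^2}\sqrt{\tfrac r{\log p}},\tfrac{\sqrt{nr}}{w\log p}\big\}\Big)$; 4. $\dfrac{1}{\sigma\rho_n}\dfrac{4\kappa_n^2}{\lambda\phi_w}=o\Big(\min\big\{\sqrt{\tfrac n{\log p}},\sqrt{\tfrac r{\log p}},\tfrac n{w^2}\sqrt{\tfrac r{\log p}},\tfrac{\sqrt{nr}}{w\log p}\big\}\Big)$; and the debiasing property holds: $\mathbb P\big(\|\Delta\|_\infty/(\sigma\rho_n)>\eta\big)\to0$ for every $\eta>0$ (for every choice of the minimizer $\widehat\theta^*$). -/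

import Mathlib

open Filter Topology Asymptotics MeasureTheory ProbabilityTheory

/-- A parameter tuple `(n, p, s₀, r, ε, δ)`: sample size, number of features, sparsity,
number of rows of the random projection, and the two privacy parameters. -/
structure ParamTuple where
  n : ℕ
  p : ℕ
  s₀ : ℕ
  r : ℕ
  ε : ℝ
  δ : ℝ

/-- The known constants of the linear model at a given dimension: the bound `b` on the entries of
the design, the noise level `σ`, and the truncation level `τ` of the noise. -/
structure ModelConsts where
  b : ℝ
  σ : ℝ
  τ : ℝ

/-- The entries of the design have a centred, normalized law supported on `[-b, b]`. -/
def IsDesignLaw (D : Measure ℝ) (b : ℝ) : Prop :=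
  IsProbabilityMeasure D ∧ (∀ᵐ x ∂D, |x| ≤ b) ∧ ∫ x, x ∂D = 0 ∧ ∫ x, x ^ 2 ∂D = 1

/-- Gaussian `N(0, σ²)` conditioned on `[-τ, τ]`. -/
noncomputable def truncatedGaussian (σ τ : ℝ) : Measure ℝ :=
  ProbabilityTheory.cond (gaussianReal 0 (σ ^ 2).toNNReal) (Set.Icc (-τ) τ)

namespace ParamTuple

variable (t : ParamTuple) (c : ModelConsts)

/-- The bound `B` on the Euclidean norm of the data rows (design, knockoff and response). -/
noncomputable def rowBound : ℝ :=
  Real.sqrt (2 * t.p * c.b ^ 2 + (c.b * Real.sqrt t.s₀ + c.τ) ^ 2)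

/-- The privacy parameter `w` of the Johnson–Lindenstrauss privatization. -/
noncomputable def w : ℝ :=
  Real.sqrt (4 * t.rowBound c ^ 2 / t.ε *
    (Real.sqrt (2 * t.r * Real.log (4 / t.δ)) + Real.log (4 / t.δ)))

/-- The Lasso penalty `λ`, with leading constant `C`. -/
noncomputable def penalty (C : ℝ) : ℝ :=
  C * c.σ * max (Real.sqrt (Real.log t.p / t.n)) (Real.sqrt (Real.log t.p ^ 3 / t.r))

noncomputable def rho : ℝ :=
  Real.sqrt (((t.n : ℝ) + t.r + 1) / (t.n * t.r) + t.w c ^ 2 / (t.n * t.r))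

noncomputable def phi : ℝ := 1 + t.w c ^ 2 / t.n

noncomputable def kappa (C : ℝ) : ℝ :=
  2 * t.penalty c C * Real.sqrt t.s₀ + t.w c ^ 2 / t.n

/-- Index set of the columns of the projection matrix `R = [R₁ R₂ R₃]`. -/
abbrev Cols : Type := Fin t.n ⊕ (Fin t.p ⊕ Unit)

/-- Outcomes `(X, ξ, R)`: design matrix, noise vector, projection matrix. -/
abbrev Sample : Type := (Fin t.n → Fin t.p → ℝ) × (Fin t.n → ℝ) × (Fin t.r → t.Cols → ℝ)

/-- Joint law of `(X, ξ, R)`: all entries are independent, those of `X` have law `D`, those of `ξ`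
are truncated Gaussian, and those of `R` are `N(0, 1/r)`. -/
noncomputable def sampleLaw (D : Measure ℝ) : Measure t.Sample :=
  (Measure.pi fun _ => Measure.pi fun _ => D).prod
    ((Measure.pi fun _ => truncatedGaussian c.σ c.τ).prod
      (Measure.pi fun _ => Measure.pi fun _ => gaussianReal 0 (1 / (t.r : NNReal))))

variable {t}

/-- The design matrix `X`. -/
def Sample.X (ω : t.Sample) : Matrix (Fin t.n) (Fin t.p) ℝ := Matrix.of ω.1

/-- The noise vector `ξ`. -/
def Sample.ξ (ω : t.Sample) : Fin t.n → ℝ := ω.2.1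

/-- The projection matrix `R`. -/
def Sample.R (ω : t.Sample) : Matrix (Fin t.r) t.Cols ℝ := Matrix.of ω.2.2

/-- The response `y = X θ₀ + ξ`. -/
def Sample.y (ω : t.Sample) (θ₀ : Fin t.p → ℝ) : Fin t.n → ℝ :=
  ω.X.mulVec θ₀ + ω.ξ

/-- The privatized data `[X* y*] = R [[X y]; w I]`. -/
noncomputable def Sample.release (ω : t.Sample) (θ₀ : Fin t.p → ℝ) :
    Matrix (Fin t.r) (Fin t.p ⊕ Unit) ℝ :=
  ω.R * Matrix.fromRows (Matrix.fromCols ω.X (Matrix.replicateCol Unit (ω.y θ₀)))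
    (t.w c • (1 : Matrix (Fin t.p ⊕ Unit) (Fin t.p ⊕ Unit) ℝ))

/-- `X*`. -/
noncomputable def Sample.privX (ω : t.Sample) (θ₀ : Fin t.p → ℝ) :
    Matrix (Fin t.r) (Fin t.p) ℝ :=
  (ω.release c θ₀).toCols₁

/-- `y*`. -/
noncomputable def Sample.privy (ω : t.Sample) (θ₀ : Fin t.p → ℝ) : Fin t.r → ℝ :=
  fun i => ω.release c θ₀ i (Sum.inr ())

/-- The private Lasso objective `‖X* θ - y*‖₂² / (2n) + λ ‖θ‖₁`. -/
noncomputable def Sample.lassoObjective (ω : t.Sample) (θ₀ : Fin t.p → ℝ) (C : ℝ)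
    (θ : Fin t.p → ℝ) : ℝ :=
  1 / (2 * t.n) * ∑ i, ((ω.privX c θ₀).mulVec θ i - ω.privy c θ₀ i) ^ 2
    + t.penalty c C * ∑ j, |θ j|

/-- `θ` is a private Lasso estimate. -/
def Sample.IsLasso (ω : t.Sample) (θ₀ : Fin t.p → ℝ) (C : ℝ) (θ : Fin t.p → ℝ) : Prop :=
  ∀ θ', ω.lassoObjective c θ₀ C θ ≤ ω.lassoObjective c θ₀ C θ'

/-- The bias
`Δ = (XᵀX / n - I)(θ₀ - θ) + (1/n) [Xᵀ wI 0] (RᵀR - I) [X(θ₀ - θ); -wθ; w]`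
of the debiased estimator built from the Lasso estimate `θ`. -/
noncomputable def Sample.bias (ω : t.Sample) (θ₀ θ : Fin t.p → ℝ) : Fin t.p → ℝ :=
  ((1 / (t.n : ℝ)) • (ω.X.transpose * ω.X) - 1).mulVec (θ₀ - θ) +
    (1 / (t.n : ℝ)) •
      (Matrix.fromCols ω.X.transpose
          (Matrix.fromCols (t.w c • (1 : Matrix (Fin t.p) (Fin t.p) ℝ))
            (0 : Matrix (Fin t.p) Unit ℝ)) *
        (ω.R.transpose * ω.R - 1)).mulVec
        (Sum.elim (ω.X.mulVec (θ₀ - θ)) (Sum.elim (-(t.w c • θ)) (fun _ => t.w c)))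

end ParamTuple

/-- The four sufficient conditions for debiasing, along a sequence of parameters. -/
def SufficientConditions (C : ℝ) (t : ℕ → ParamTuple) (c : ℕ → ModelConsts) : Prop :=
  ((fun k => (t k).kappa (c k) C ^ 2 / ((t k).penalty (c k) C ^ 2 * (t k).phi (c k))) =o[atTop]
    fun k => Real.sqrt ((t k).n / Real.log (t k).p) *
      min 1 (min (Real.sqrt ((t k).r / (t k).n))
        (Real.sqrt ((t k).r * (t k).n) / (t k).w (c k) ^ 2))) ∧
  ((fun k => Real.sqrt (t k).s₀) =O[atTop]
    fun k => max (1 / Real.sqrt (t k).n) (Real.log (t k).p / Real.sqrt (t k).r) /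
      max ((t k).w (c k) * Real.log (t k).p / Real.sqrt ((t k).n * (t k).r))
        ((t k).w (c k) ^ 2 / (t k).n * Real.sqrt (Real.log (t k).p / (t k).r))) ∧
  ((fun k => 1 / ((c k).σ * (t k).rho (c k)) * Real.sqrt (t k).s₀) =o[atTop]
    fun k => min ((t k).n / (t k).w (c k) ^ 2 * Real.sqrt ((t k).r / Real.log (t k).p))
      (Real.sqrt ((t k).n * (t k).r) / ((t k).w (c k) * Real.log (t k).p))) ∧
  ((fun k => 1 / ((c k).σ * (t k).rho (c k)) *
      (4 * (t k).kappa (c k) C ^ 2 / ((t k).penalty (c k) C * (t k).phi (c k)))) =o[atTop]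
    fun k => min (Real.sqrt ((t k).n / Real.log (t k).p))
      (min (Real.sqrt ((t k).r / Real.log (t k).p))
        (min ((t k).n / (t k).w (c k) ^ 2 * Real.sqrt ((t k).r / Real.log (t k).p))
          (Real.sqrt ((t k).n * (t k).r) / ((t k).w (c k) * Real.log (t k).p)))))

/-- The debiasing property `‖Δ‖_∞ = o_p(σ ρ_n)`: the probability that some private Lasso estimate
has `‖Δ‖_∞ / (σ ρ_n) > η` tends to zero for every `η > 0`. The norm on `Fin p → ℝ` is the
sup norm. -/
def DebiasingProperty (C : ℝ) (t : ℕ → ParamTuple) (c : ℕ → ModelConsts) (D : Measure ℝ)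
    (θ₀ : (k : ℕ) → Fin (t k).p → ℝ) : Prop :=
  ∀ η : ℝ, 0 < η →
    Tendsto (fun k => (t k).sampleLaw (c k) D
      {ω | ∃ θ, ParamTuple.Sample.IsLasso (c k) ω (θ₀ k) C θ ∧
        η < ‖ParamTuple.Sample.bias (c k) ω (θ₀ k) θ‖ / ((c k).σ * (t k).rho (c k))})
      atTop (𝓝 0)

/-!
Take `r` of order `p ^ β` with `max α (4 - 2γ) < β < 3α/2 + 2γ - 2`. Then `w²` is of order at most
`p ^ (1 - γ + β/2)` up to logarithms, hence negligible compared with `n`, and each of the four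
conditions reduces to an inequality between exponents.

For the bias, write `S = [X; wI; 0]` and `M = RᵀR - I`. The Gram matrix of the release is
`(n + w²) I + n E` with `n E = (XᵀX - nI) + SᵀMS`, and the bias is
`E (θ₀ - θ) + (w/n) SᵀM (0; -θ₀; 1)`. Hoeffding's inequality controls `XᵀX - nI` and `Xᵀξ`; a
chi-square tail bound and polarization control the `O(p²)` inner products that `R` distorts. The
entries of `E` are then about `n ^ (-1/2)`, and since `p` is small compared with `√n` the Gram
matrix is well conditioned with respect to the `ℓ¹` norm. The basic inequality of the Lasso
therefore gives `‖θ₀ - θ‖₁ ≤ p ^ (1/2 - α/4 + o(1))`, which tends to zero, so that `‖Δ‖_∞` is of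
smaller order than `σ / √n ≤ σ ρ_n`.
-/

section Tails

variable {Ω ι : Type*} {mΩ : MeasurableSpace Ω} {μ : Measure Ω}

lemma measureReal_le_abs_le [IsFiniteMeasure μ] {f : Ω → ℝ} {t q : ℝ}
    (hpos : μ.real {ω | t ≤ f ω} ≤ q) (hneg : μ.real {ω | t ≤ -f ω} ≤ q) :
    μ.real {ω | t ≤ |f ω|} ≤ 2 * q :=
  calc μ.real {ω | t ≤ |f ω|} = μ.real ({ω | t ≤ f ω} ∪ {ω | t ≤ -f ω}) := by
        simp only [le_abs, Set.ofPred_or]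
    _ ≤ μ.real {ω | t ≤ f ω} + μ.real {ω | t ≤ -f ω} := measureReal_union_le _ _
    _ ≤ 2 * q := by linarith

variable [Fintype ι] {X : ι → Ω → ℝ}

lemma measureReal_le_sum_le_of_mgf_le (hindep : iIndepFun X μ) (hX : ∀ i, Measurable (X i))
    {x K : ℝ} (hx : 0 ≤ x) (hint : ∀ i, Integrable (fun ω => Real.exp (x * X i ω)) μ)
    (hmgf : ∀ i, mgf (X i) μ x ≤ Real.exp K) (t : ℝ) :
    μ.real {ω | t ≤ ∑ i, X i ω} ≤ Real.exp (Fintype.card ι * K - x * t) := by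
  have := hindep.isProbabilityMeasure
  have hchernoff : μ.real {ω | t ≤ (∑ i, X i) ω} ≤ Real.exp (-x * t) * ∏ i, mgf (X i) μ x := by
    rw [← hindep.mgf_sum hX]
    exact measure_ge_le_exp_mul_mgf t hx (hindep.integrable_exp_mul_sum hX fun i _ => hint i)
  have hprod : ∏ i, mgf (X i) μ x ≤ Real.exp (Fintype.card ι * K) :=
    calc ∏ i, mgf (X i) μ x ≤ ∏ _i : ι, Real.exp K :=
          Finset.prod_le_prod (fun _ _ => mgf_nonneg) fun i _ => hmgf i
      _ = Real.exp (Fintype.card ι * K) := by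
          rw [Finset.prod_const, ← Real.exp_nat_mul, Finset.card_univ]
  simp only [Finset.sum_apply] at hchernoff
  calc μ.real {ω | t ≤ ∑ i, X i ω} ≤ Real.exp (-x * t) * Real.exp (Fintype.card ι * K) :=
        hchernoff.trans (mul_le_mul_of_nonneg_left hprod (Real.exp_pos _).le)
    _ = Real.exp (Fintype.card ι * K - x * t) := by rw [← Real.exp_add]; ring_nf

lemma measureReal_le_abs_sum_le_of_abs_le (hindep : iIndepFun X μ) (hX : ∀ i, Measurable (X i))
    {M : ℝ} (hM : ∀ i, ∀ᵐ ω ∂μ, |X i ω| ≤ M) (hmean : ∀ i, ∫ ω, X i ω ∂μ = 0) {t : ℝ}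
    (ht : 0 ≤ t) :
    μ.real {ω | t ≤ |∑ i, X i ω|} ≤ 2 * Real.exp (-t ^ 2 / (2 * (Fintype.card ι * M ^ 2))) := by
  have := hindep.isProbabilityMeasure
  have hsub (i : ι) : HasSubgaussianMGF (X i) ((‖M - -M‖₊ / 2) ^ 2) μ :=
    hasSubgaussianMGF_of_mem_Icc_of_integral_eq_zero (hX i).aemeasurable
      ((hM i).mono fun ω h => abs_le.mp h) (hmean i)
  have hvar : ((∑ _i : ι, (‖M - -M‖₊ / 2) ^ 2 : NNReal) : ℝ) = Fintype.card ι * M ^ 2 := by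
    simp only [Finset.sum_const, Finset.card_univ, nsmul_eq_mul]
    push_cast
    rw [sub_neg_eq_add, ← two_mul, norm_mul, Real.norm_ofNat,
      mul_div_cancel_left₀ _ two_ne_zero, Real.norm_eq_abs, sq_abs]
  have hneg : iIndepFun (fun i ω => -X i ω) μ := hindep.comp (fun _ x => -x) fun _ => measurable_neg
  refine measureReal_le_abs_le ?_ ?_
  · rw [← hvar]
    exact HasSubgaussianMGF.measure_sum_ge_le_of_iIndepFun hindep (fun i _ => hsub i) ht
  · simp only [← hvar, ← Finset.sum_neg_distrib]
    exact HasSubgaussianMGF.measure_sum_ge_le_of_iIndepFun hneg (fun i _ => (hsub i).neg) ht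

lemma measureReal_pi_le_abs_sum_le_of_abs_le [IsProbabilityMeasure μ] {f : ι → Ω → ℝ}
    (hf : ∀ i, Measurable (f i)) {M : ℝ} (hM : ∀ i, ∀ᵐ ω ∂μ, |f i ω| ≤ M)
    (hmean : ∀ i, ∫ ω, f i ω ∂μ = 0) {t : ℝ} (ht : 0 ≤ t) :
    (Measure.pi fun _ : ι => μ).real {ω | t ≤ |∑ i, f i (ω i)|} ≤
      2 * Real.exp (-t ^ 2 / (2 * (Fintype.card ι * M ^ 2))) :=
  measureReal_le_abs_sum_le_of_abs_le (iIndepFun_pi fun i => (hf i).aemeasurable)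
    (fun i => (hf i).comp (measurable_pi_apply i))
    (fun i => (measurePreserving_eval (fun _ => μ) i).quasiMeasurePreserving.ae (hM i))
    (fun i => (integral_comp_eval (hf i).aestronglyMeasurable).trans (hmean i)) ht

end Tails

section ChiSquare

lemma integrable_exp_mul_sq_gaussianReal {x : ℝ} (hx : x < 1 / 2) :
    Integrable (fun y => Real.exp (x * y ^ 2)) (gaussianReal 0 1) := by
  rw [gaussianReal_of_var_ne_zero _ one_ne_zero, gaussianPDF_def,
    integrable_withDensity_iff_integrable_smul' (by fun_prop) (by simp)]
  refine ((integrable_exp_neg_mul_sq (b := 1 / 2 - x) (by linarith)).const_mul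
    (√(2 * Real.pi))⁻¹).congr (.of_forall fun y => ?_)
  simp only [smul_eq_mul, ENNReal.toReal_ofReal (gaussianPDFReal_nonneg _ _ _)]
  simp only [gaussianPDFReal, NNReal.coe_one, mul_one, sub_zero]
  rw [mul_assoc, ← Real.exp_add]
  ring_nf

lemma integral_exp_mul_sq_gaussianReal {x : ℝ} (hx : x < 1 / 2) :
    ∫ y, Real.exp (x * y ^ 2) ∂(gaussianReal 0 1) = (√(1 - 2 * x))⁻¹ := by
  have hdensity (y : ℝ) : gaussianPDFReal 0 1 y • Real.exp (x * y ^ 2) =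
      (√(2 * Real.pi))⁻¹ * Real.exp (-(1 / 2 - x) * y ^ 2) := by
    simp only [smul_eq_mul, gaussianPDFReal, NNReal.coe_one, mul_one, sub_zero]
    rw [mul_assoc, ← Real.exp_add]
    ring_nf
  have : 1 - 2 * x ≠ 0 := by linarith
  have : 1 / 2 - x ≠ 0 := by linarith
  simp_rw [integral_gaussianReal_eq_integral_smul one_ne_zero, hdensity]
  rw [integral_const_mul, integral_gaussian, ← Real.sqrt_inv, ← Real.sqrt_inv,
    ← Real.sqrt_mul (by positivity)]
  congr 1
  field_simp

lemma inv_sqrt_one_sub_two_mul_le_exp {x : ℝ} (hx : |x| ≤ 1 / 4) :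
    (√(1 - 2 * x))⁻¹ ≤ Real.exp (x + 4 * x ^ 2) := by
  have hpos : 0 < 1 - 2 * x := by linarith [(abs_le.mp hx).2]
  have habs : |2 * x| ≤ 1 / 2 := by rw [abs_mul, abs_two]; linarith
  have hremainder : (2 * x) ^ 2 / (1 - |2 * x|) ≤ 2 * (2 * x) ^ 2 := by
    rw [div_le_iff₀ (by linarith)]
    nlinarith [sq_nonneg (2 * x)]
  have hlog : |2 * x + Real.log (1 - 2 * x)| ≤ 2 * (2 * x) ^ 2 := by
    have h := Real.abs_log_sub_add_sum_range_le (x := 2 * x) (by linarith) 1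
    simp only [Finset.range_one, Finset.sum_singleton, Nat.cast_zero, zero_add, pow_one, div_one,
      one_add_one_eq_two, sq_abs] at h
    exact h.trans hremainder
  rw [Real.sqrt_eq_rpow, Real.rpow_def_of_pos hpos, ← Real.exp_neg, Real.exp_le_exp]
  linarith [(abs_le.mp hlog).1]

lemma integrable_exp_mul_sq_sub_one_gaussianReal {x : ℝ} (hx : x < 1 / 2) :
    Integrable (fun y => Real.exp (x * (y ^ 2 - 1))) (gaussianReal 0 1) := by
  simpa only [mul_sub, mul_one, Real.exp_sub] using
    (integrable_exp_mul_sq_gaussianReal hx).div_const (Real.exp x)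

lemma integral_exp_mul_sq_sub_one_gaussianReal_le {x : ℝ} (hx : |x| ≤ 1 / 4) :
    ∫ y, Real.exp (x * (y ^ 2 - 1)) ∂(gaussianReal 0 1) ≤ Real.exp (4 * x ^ 2) :=
  calc ∫ y, Real.exp (x * (y ^ 2 - 1)) ∂(gaussianReal 0 1)
      = (√(1 - 2 * x))⁻¹ / Real.exp x := by
        simp only [mul_sub, mul_one, Real.exp_sub]
        rw [integral_div, integral_exp_mul_sq_gaussianReal (by linarith [(abs_le.mp hx).2])]
    _ ≤ Real.exp (x + 4 * x ^ 2) / Real.exp x :=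
        div_le_div_of_nonneg_right (inv_sqrt_one_sub_two_mul_le_exp hx) (Real.exp_pos _).le
    _ = Real.exp (4 * x ^ 2) := by rw [← Real.exp_sub, add_sub_cancel_left]

variable {Ω ι : Type*} {mΩ : MeasurableSpace Ω} {μ : Measure Ω} [Fintype ι] {g : ι → Ω → ℝ}

lemma measureReal_le_abs_sum_sq_sub_one_le (hindep : iIndepFun g μ) (hg : ∀ i, Measurable (g i))
    (hlaw : ∀ i, HasLaw (g i) (gaussianReal 0 1) μ) {t : ℝ} (ht0 : 0 ≤ t) (ht1 : t ≤ 1) :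
    μ.real {ω | Fintype.card ι * t ≤ |∑ i, (g i ω ^ 2 - 1)|} ≤
      2 * Real.exp (-(Fintype.card ι * t ^ 2) / 16) := by
  have := hindep.isProbabilityMeasure
  have hside (s : ℝ) (hs : |s| = 1) :
      μ.real {ω | Fintype.card ι * t ≤ ∑ i, s * (g i ω ^ 2 - 1)} ≤
        Real.exp (-(Fintype.card ι * t ^ 2) / 16) := by
    have hx : |t / 8 * s| ≤ 1 / 4 := by
      rw [abs_mul, hs, mul_one, abs_of_nonneg (by linarith)]
      linarith
    have hmeas : Measurable fun y : ℝ => s * (y ^ 2 - 1) := by fun_prop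
    have hmgf (i : ι) :
        mgf (fun ω => s * (g i ω ^ 2 - 1)) μ (t / 8) ≤ Real.exp (4 * (t / 8) ^ 2) := by
      have h := integral_exp_mul_sq_sub_one_gaussianReal_le hx
      rw [← (hlaw i).integral_comp (by fun_prop), mul_pow (t / 8), ← sq_abs s, hs] at h
      simpa only [mgf, mul_assoc, Function.comp_def, one_pow, mul_one] using h
    have hint (i : ι) : Integrable (fun ω => Real.exp (t / 8 * (s * (g i ω ^ 2 - 1)))) μ := by
      have h := integrable_exp_mul_sq_sub_one_gaussianReal (x := t / 8 * s)
        (by linarith [(abs_le.mp hx).2])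
      simpa only [mul_assoc, Function.comp_def] using
        ((hlaw i).measurePreserving (hg i)).integrable_comp_of_integrable h
    refine (measureReal_le_sum_le_of_mgf_le (hindep.comp (fun _ y => s * (y ^ 2 - 1))
      fun _ => hmeas) (fun i => hmeas.comp (hg i)) (by linarith) hint hmgf _).trans_eq ?_
    ring_nf
  refine measureReal_le_abs_le ?_ ?_
  · simpa only [one_mul] using hside 1 abs_one
  · simpa only [neg_mul, one_mul, Finset.sum_neg_distrib] using hside (-1) (by simp)

end ChiSquare

section GaussianProjection

open Matrix

variable {ι κ : Type*} [Fintype ι] [Fintype κ]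

lemma dotProduct_self_nonneg (v : κ → ℝ) : 0 ≤ v ⬝ᵥ v :=
  dotProduct_star_self_nonneg v

lemma dotProduct_self_pos {v : κ → ℝ} (hv : v ≠ 0) : 0 < v ⬝ᵥ v :=
  dotProduct_star_self_pos_iff.mpr hv

lemma hasLaw_sum_gaussianReal {Ω : Type*} {mΩ : MeasurableSpace Ω} {μ : Measure Ω}
    {g : κ → Ω → ℝ} {m : κ → ℝ} {v : κ → NNReal} (hindep : iIndepFun g μ)
    (hlaw : ∀ k, HasLaw (g k) (gaussianReal (m k) (v k)) μ) :
    HasLaw (fun ω => ∑ k, g k ω) (gaussianReal (∑ k, m k) (∑ k, v k)) μ := by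
  have := hindep.isProbabilityMeasure
  have hg (k : κ) : AEMeasurable (g k) μ := (hlaw k).aemeasurable
  have hsum : AEMeasurable (fun ω => ∑ k, g k ω) μ := Finset.aemeasurable_fun_sum _ fun k _ => hg k
  have := Measure.isProbabilityMeasure_map hsum
  refine ⟨hsum, Measure.ext_of_charFun ?_⟩
  rw [hindep.charFun_map_fun_sum_eq_prod hg]
  ext x
  simp only [Finset.prod_apply, (hlaw _).map_eq, charFun_gaussianReal, ← Complex.exp_sum]
  push_cast
  rw [Finset.sum_sub_distrib, Finset.mul_sum, Finset.sum_mul, Finset.sum_mul, Finset.sum_div]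

lemma hasLaw_dotProduct_pi_gaussianReal (u : NNReal) (a : κ → ℝ) :
    HasLaw (fun x => x ⬝ᵥ a) (gaussianReal 0 (.mk (a ⬝ᵥ a) (dotProduct_self_nonneg a) * u))
      (Measure.pi fun _ => gaussianReal 0 u) := by
  have hterm (k : κ) : HasLaw (fun x : κ → ℝ => x k * a k)
      (gaussianReal 0 (.mk (a k ^ 2) (sq_nonneg _) * u))
      (Measure.pi fun _ => gaussianReal 0 u) := by
    simpa using gaussianReal_mul_const
      (measurePreserving_eval (fun _ : κ => gaussianReal 0 u) k).hasLaw (a k)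
  have hindep : iIndepFun (fun k (x : κ → ℝ) => x k * a k) (Measure.pi fun _ => gaussianReal 0 u) :=
    iIndepFun_pi (X := fun k y => y * a k) fun k => by fun_prop
  have hvar : .mk (a ⬝ᵥ a) (dotProduct_self_nonneg a) * u =
      ∑ k, .mk (a k ^ 2) (sq_nonneg _) * u := by
    ext
    simp only [dotProduct, ← sq, NNReal.coe_sum, NNReal.coe_mul, NNReal.coe_mk, Finset.sum_mul]
  have hsum := hasLaw_sum_gaussianReal hindep hterm
  rwa [Finset.sum_const_zero, ← hvar] at hsum

variable (ι κ) in
/-- The law of a Gaussian random projection: independent `N(0, 1/m)` entries, where `m` is the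
number of rows, so that `‖R v‖² = ‖v‖²` in mean. -/
noncomputable def gaussianProjection : Measure (ι → κ → ℝ) :=
  Measure.pi fun _ => Measure.pi fun _ => gaussianReal 0 (1 / (Fintype.card ι : NNReal))

instance : IsProbabilityMeasure (gaussianProjection ι κ) := by
  unfold gaussianProjection
  infer_instance

lemma gaussianProjection_normSq_deviation [Nonempty ι] (v : κ → ℝ) {t : ℝ} (ht0 : 0 ≤ t)
    (ht1 : t ≤ 1) :
    (gaussianProjection ι κ).real
        {R | t * (v ⬝ᵥ v) < |(of R *ᵥ v) ⬝ᵥ (of R *ᵥ v) - v ⬝ᵥ v|} ≤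
      2 * Real.exp (-(Fintype.card ι * t ^ 2) / 16) := by
  rcases eq_or_ne v 0 with rfl | hv
  · simp [Real.exp_nonneg]
  set m := (Fintype.card ι : ℝ) with hm
  have hm0 : 0 < m := Nat.cast_pos.mpr Fintype.card_pos
  have hq0 : 0 < v ⬝ᵥ v := dotProduct_self_pos hv
  set q := v ⬝ᵥ v with hq
  have hmeas : Measurable fun x : κ → ℝ => √(m / q) * (x ⬝ᵥ v) := by
    unfold dotProduct
    fun_prop
  set ν := Measure.pi fun _ : κ => gaussianReal 0 (1 / (Fintype.card ι : NNReal))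
  have hlaw : HasLaw (fun x => √(m / q) * (x ⬝ᵥ v)) (gaussianReal 0 1) ν := by
    convert gaussianReal_const_mul (hasLaw_dotProduct_pi_gaussianReal _ v) (√(m / q)) using 2
    · simp
    · ext
      simp only [NNReal.coe_one, NNReal.coe_mul, NNReal.coe_mk, NNReal.coe_div, NNReal.coe_natCast,
        ← hq, ← hm, Real.sq_sqrt (div_pos hm0 hq0).le]
      field_simp
  have hsum (R : ι → κ → ℝ) : ∑ i, ((√(m / q) * (R i ⬝ᵥ v)) ^ 2 - 1) =
      m * (((of R *ᵥ v) ⬝ᵥ (of R *ᵥ v) - q) / q) := by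
    simp only [mul_pow, Real.sq_sqrt (div_pos hm0 hq0).le, Finset.sum_sub_distrib, Finset.sum_const,
      Finset.card_univ, nsmul_eq_mul, mul_one, ← Finset.mul_sum, ← hm]
    simp only [sq, ← dotProduct.eq_1 (fun i => R i ⬝ᵥ v)]
    change m / q * ((of R *ᵥ v) ⬝ᵥ (of R *ᵥ v)) - m = _
    field_simp
  refine (measureReal_mono fun R hR => ?_).trans (measureReal_le_abs_sum_sq_sub_one_le
    (iIndepFun_pi fun _ => hmeas.aemeasurable) (fun i => hmeas.comp (measurable_pi_apply i))
    (fun i => hlaw.comp (measurePreserving_eval (fun _ => ν) i).hasLaw) ht0 ht1)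
  rw [Set.mem_ofPred_eq, hsum, abs_mul, abs_of_pos hm0, abs_div, abs_of_pos hq0]
  gcongr
  exact ((lt_div_iff₀ hq0).mpr hR).le

lemma abs_mulVec_dotProduct_mulVec_sub_le {A : Matrix ι κ ℝ} {a c : κ → ℝ} {t : ℝ}
    (hadd : |(A *ᵥ (a + c)) ⬝ᵥ (A *ᵥ (a + c)) - (a + c) ⬝ᵥ (a + c)| ≤ t * ((a + c) ⬝ᵥ (a + c)))
    (hsub : |(A *ᵥ (a - c)) ⬝ᵥ (A *ᵥ (a - c)) - (a - c) ⬝ᵥ (a - c)| ≤ t * ((a - c) ⬝ᵥ (a - c))) :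
    |(A *ᵥ a) ⬝ᵥ (A *ᵥ c) - a ⬝ᵥ c| ≤ t * ((a ⬝ᵥ a + c ⬝ᵥ c) / 2) := by
  simp only [mulVec_add, mulVec_sub, add_dotProduct, dotProduct_add, sub_dotProduct,
    dotProduct_sub, dotProduct_comm (A *ᵥ c) (A *ᵥ a), dotProduct_comm c a] at hadd hsub
  rw [abs_le] at hadd hsub ⊢
  constructor <;> linarith [hadd.1, hadd.2, hsub.1, hsub.2]

/-- The matrix `A` preserves the inner product of `u` and `v` up to an error `e ‖u‖ ‖v‖`. -/
def ApproxPreservesInner (A : Matrix ι κ ℝ) (e : ℝ) (u v : κ → ℝ) : Prop :=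
  |(A *ᵥ u) ⬝ᵥ (A *ᵥ v) - u ⬝ᵥ v| ≤ e * (√(u ⬝ᵥ u) * √(v ⬝ᵥ v))

lemma gaussianProjection_inner_deviation [Nonempty ι] (a c : κ → ℝ) {t : ℝ}
    (ht0 : 0 ≤ t) (ht1 : t ≤ 1) :
    (gaussianProjection ι κ).real
        {R | ¬ ApproxPreservesInner (of R) t a c} ≤
      4 * Real.exp (-(Fintype.card ι * t ^ 2) / 16) := by
  rcases eq_or_ne a 0 with rfl | ha
  · simp [ApproxPreservesInner, Real.exp_nonneg]
  rcases eq_or_ne c 0 with rfl | hc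
  · simp [ApproxPreservesInner, Real.exp_nonneg]
  set x := √(a ⬝ᵥ a)
  set y := √(c ⬝ᵥ c)
  have hx : x ^ 2 = a ⬝ᵥ a := Real.sq_sqrt (dotProduct_self_nonneg a)
  have hy : y ^ 2 = c ⬝ᵥ c := Real.sq_sqrt (dotProduct_self_nonneg c)
  have hxy : 0 < x * y := mul_pos (Real.sqrt_pos.mpr (dotProduct_self_pos ha))
    (Real.sqrt_pos.mpr (dotProduct_self_pos hc))
  let bad (v : κ → ℝ) : Set (ι → κ → ℝ) :=
    {R | t * (v ⬝ᵥ v) < |(of R *ᵥ v) ⬝ᵥ (of R *ᵥ v) - v ⬝ᵥ v|}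
  -- Polarization is applied to the multiples `y • a` and `x • c`, which have the same norm `x * y`.
  have hsubset : {R : ι → κ → ℝ | ¬ ApproxPreservesInner (of R) t a c} ⊆
      bad (y • a + x • c) ∪ bad (y • a - x • c) := by
    intro R
    contrapose!
    intro hgood
    simp only [bad, Set.mem_union, Set.mem_ofPred_eq, not_or, not_lt] at hgood
    have h := abs_mulVec_dotProduct_mulVec_sub_le hgood.1 hgood.2
    simp only [mulVec_smul, smul_dotProduct, dotProduct_smul, smul_eq_mul, ← hx, ← hy] at h
    rw [← mul_assoc, ← mul_assoc, ← mul_sub, abs_mul, abs_of_pos hxy,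
      show t * ((y * (y * x ^ 2) + x * (x * y ^ 2)) / 2) = x * y * (t * (x * y)) by ring] at h
    exact not_not.mpr (le_of_mul_le_mul_left h hxy)
  calc (gaussianProjection ι κ).real {R | ¬ ApproxPreservesInner (of R) t a c}
      ≤ (gaussianProjection ι κ).real (bad (y • a + x • c)) +
          (gaussianProjection ι κ).real (bad (y • a - x • c)) :=
        (measureReal_mono hsubset).trans (measureReal_union_le _ _)
    _ ≤ 4 * Real.exp (-(Fintype.card ι * t ^ 2) / 16) := by
        linarith [gaussianProjection_normSq_deviation (ι := ι) (y • a + x • c) ht0 ht1,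
          gaussianProjection_normSq_deviation (ι := ι) (y • a - x • c) ht0 ht1]

end GaussianProjection

section ProductMeasure

variable {α β ι : Type*} {mα : MeasurableSpace α} {mβ : MeasurableSpace β}
  {μ : Measure α} {ν : Measure β}

lemma ae_pi_forall [Fintype ι] [SigmaFinite μ] {P : α → Prop} (h : ∀ᵐ x ∂μ, P x) :
    ∀ᵐ x ∂(Measure.pi fun _ : ι => μ), ∀ i, P (x i) :=
  eventually_all.2 fun _ => (Measure.tendsto_eval_ae_ae (μ := fun _ : ι => μ)).eventually h

lemma measureReal_prod_le_of_ae_fst [IsProbabilityMeasure μ] [IsProbabilityMeasure ν]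
    {S : Set (α × β)} (hS : MeasurableSet S) {q : ℝ}
    (h : ∀ᵐ x ∂μ, ν.real {y | (x, y) ∈ S} ≤ q) : (μ.prod ν).real S ≤ q := by
  obtain ⟨x, hx⟩ := h.exists
  have hslice : ∀ᵐ x ∂μ, ν (Prod.mk x ⁻¹' S) ≤ ENNReal.ofReal q := h.mono fun x hx => by
    rw [← ofReal_measureReal]
    exact ENNReal.ofReal_le_ofReal hx
  refine ENNReal.toReal_le_of_le_ofReal (measureReal_nonneg.trans hx) ?_
  calc μ.prod ν S = ∫⁻ x, ν (Prod.mk x ⁻¹' S) ∂μ := Measure.prod_apply hS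
    _ ≤ ∫⁻ _, ENNReal.ofReal q ∂μ := lintegral_mono_ae hslice
    _ = ENNReal.ofReal q := by simp

lemma measureReal_prod_le_of_ae_snd [IsProbabilityMeasure μ] [IsProbabilityMeasure ν]
    {S : Set (α × β)} (hS : MeasurableSet S) {q : ℝ}
    (h : ∀ᵐ y ∂ν, μ.real {x | (x, y) ∈ S} ≤ q) : (μ.prod ν).real S ≤ q := by
  rw [← Measure.prod_swap, map_measureReal_apply measurable_swap hS]
  exact measureReal_prod_le_of_ae_fst (measurable_swap hS) h

lemma measureReal_not_nonpos_of_ae [IsFiniteMeasure μ] {P : α → Prop} (hP : ∀ᵐ x ∂μ, P x) :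
    μ.real {x | ¬ P x} ≤ 0 :=
  ((measureReal_eq_zero_iff (measure_ne_top _ _)).mpr (ae_iff.mp hP)).le

lemma measureReal_not_and_le [IsFiniteMeasure μ] {P Q : α → Prop} {a b : ℝ}
    (hP : μ.real {x | ¬ P x} ≤ a) (hQ : μ.real {x | ¬ Q x} ≤ b) :
    μ.real {x | ¬ (P x ∧ Q x)} ≤ a + b := by
  simp only [not_and_or, Set.ofPred_or]
  exact (measureReal_union_le _ _).trans (add_le_add hP hQ)

lemma measureReal_not_forall_le [Fintype ι] {P : ι → α → Prop} {q : ℝ}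
    (hP : ∀ i, μ.real {x | ¬ P i x} ≤ q) :
    μ.real {x | ¬ ∀ i, P i x} ≤ Fintype.card ι * q := by
  simp only [not_forall, Set.ofPred_exists]
  refine (measureReal_iUnion_fintype_le _).trans ((Finset.sum_le_sum fun i _ => hP i).trans_eq ?_)
  rw [Finset.sum_const, Finset.card_univ, nsmul_eq_mul]

end ProductMeasure

namespace IsDesignLaw

open Matrix

variable {D : Measure ℝ} {b : ℝ}

lemma one_le_sq (h : IsDesignLaw D b) : 1 ≤ b ^ 2 := by
  obtain ⟨_, hb, -, hvar⟩ := h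
  have hle : ∫ x, x ^ 2 ∂D ≤ ∫ _, b ^ 2 ∂D :=
    integral_mono_of_nonneg (.of_forall fun x => sq_nonneg x) (integrable_const _)
      (hb.mono fun x hx => sq_le_sq.mpr (hx.trans (le_abs_self b)))
  simpa [hvar] using hle

lemma pos (h : IsDesignLaw D b) : 0 < b := by
  have := h.1
  obtain ⟨x, hx⟩ := h.2.1.exists
  exact ((abs_nonneg x).trans hx).lt_of_ne' fun h0 =>
    absurd h.one_le_sq (by norm_num [h0])

variable {ι κ : Type*} [Fintype ι] [Fintype κ]

lemma ae_pi_abs_le (h : IsDesignLaw D b) : ∀ᵐ x ∂(Measure.pi fun _ : κ => D), ∀ j, |x j| ≤ b :=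
  have := h.1
  ae_pi_forall h.2.1

lemma integral_pi_eval (h : IsDesignLaw D b) (j : κ) :
    ∫ x, x j ∂(Measure.pi fun _ : κ => D) = 0 :=
  have := h.1
  (integral_comp_eval (μ := fun _ : κ => D) (f := fun x => x)
    (by fun_prop)).trans h.2.2.1

lemma integral_pi_mul_sub_one_apply [DecidableEq κ] (h : IsDesignLaw D b) (j k : κ) :
    ∫ x, (x j * x k - (1 : Matrix κ κ ℝ) j k) ∂(Measure.pi fun _ : κ => D) = 0 := by
  have := h.1
  have hint : Integrable (fun x : κ → ℝ => x j * x k) (Measure.pi fun _ : κ => D) :=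
    .of_bound (by fun_prop) (b * b) <| h.ae_pi_abs_le.mono fun x hx => by
      rw [Real.norm_eq_abs, abs_mul]
      exact mul_le_mul (hx j) (hx k) (abs_nonneg _) h.pos.le
  rw [integral_sub hint (integrable_const _), integral_const, probReal_univ, one_smul, sub_eq_zero]
  rcases eq_or_ne j k with rfl | hjk
  · simp only [← sq, one_apply_eq]
    exact (integral_comp_eval (μ := fun _ : κ => D) (f := fun x => x ^ 2)
      (by fun_prop)).trans h.2.2.2
  · have hindep : iIndepFun (fun i (x : κ → ℝ) => x i) (Measure.pi fun _ : κ => D) :=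
      iIndepFun_pi (X := fun _ => id) fun _ => aemeasurable_id
    rw [(hindep.indepFun hjk).integral_fun_mul_eq_mul_integral
      (measurable_pi_apply j).aestronglyMeasurable (measurable_pi_apply k).aestronglyMeasurable,
      h.integral_pi_eval, zero_mul, one_apply_ne hjk]

variable [Nonempty ι]

lemma gram_deviation [DecidableEq κ] (h : IsDesignLaw D b) (j k : κ) {L : ℝ} (hL : 0 ≤ L) :
    (Measure.pi fun _ : ι => Measure.pi fun _ : κ => D).real
        {x | ¬ |((of x)ᵀ * of x - (Fintype.card ι : ℝ) • (1 : Matrix κ κ ℝ)) j k| ≤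
          √(Fintype.card ι) * L} ≤
      2 * Real.exp (-L ^ 2 / (2 * (b ^ 2 + 1) ^ 2)) := by
  have := h.1
  have hentry (x : ι → κ → ℝ) : ((of x)ᵀ * of x - (Fintype.card ι : ℝ) • (1 : Matrix κ κ ℝ)) j k =
      ∑ i, (x i j * x i k - (1 : Matrix κ κ ℝ) j k) := by
    simp [mul_apply, Finset.sum_sub_distrib]
  have hbound : ∀ᵐ x ∂(Measure.pi fun _ : κ => D),
      |x j * x k - (1 : Matrix κ κ ℝ) j k| ≤ b ^ 2 + 1 := h.ae_pi_abs_le.mono fun x hx => by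
    refine (abs_sub _ _).trans (add_le_add ?_ ?_)
    · rw [abs_mul, sq]
      exact mul_le_mul (hx j) (hx k) (abs_nonneg _) h.pos.le
    · rw [one_apply]
      split_ifs <;> simp
  simp only [hentry]
  refine (measureReal_mono fun x hx => (not_le.mp hx).le).trans
    ((measureReal_pi_le_abs_sum_le_of_abs_le
      (f := fun _ (x : κ → ℝ) => x j * x k - (1 : Matrix κ κ ℝ) j k) (fun _ => by fun_prop)
      (fun _ => hbound) (fun _ => h.integral_pi_mul_sub_one_apply j k)
      (t := √(Fintype.card ι) * L) (by positivity)).trans_eq ?_)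
  have : (Fintype.card ι : ℝ) ≠ 0 := Nat.cast_ne_zero.mpr Fintype.card_ne_zero
  rw [mul_pow, Real.sq_sqrt (Nat.cast_nonneg _)]
  field_simp

lemma correlation_deviation (h : IsDesignLaw D b) {τ : ℝ} (hτ : 0 < τ) {ξ : ι → ℝ}
    (hξ : ∀ i, |ξ i| ≤ τ) (j : κ) {L : ℝ} (hL : 0 ≤ L) :
    (Measure.pi fun _ : ι => Measure.pi fun _ : κ => D).real
        {x | ¬ |((of x)ᵀ *ᵥ ξ) j| ≤ √(Fintype.card ι) * L * τ} ≤
      2 * Real.exp (-L ^ 2 / (2 * b ^ 2)) := by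
  have := h.1
  have hbound (i : ι) : ∀ᵐ x ∂(Measure.pi fun _ : κ => D), |x j * ξ i| ≤ b * τ :=
    h.ae_pi_abs_le.mono fun x hx => by
      rw [abs_mul]
      exact mul_le_mul (hx j) (hξ i) (abs_nonneg _) h.pos.le
  refine (measureReal_mono fun x hx => (not_le.mp hx).le).trans
    ((measureReal_pi_le_abs_sum_le_of_abs_le (f := fun i (x : κ → ℝ) => x j * ξ i)
      (fun _ => by fun_prop) hbound
      (fun i => by rw [integral_mul_const, h.integral_pi_eval, zero_mul])
      (t := √(Fintype.card ι) * L * τ) (by positivity)).trans_eq ?_)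
  have : (Fintype.card ι : ℝ) ≠ 0 := Nat.cast_ne_zero.mpr Fintype.card_ne_zero
  have := h.pos.ne'
  rw [mul_pow, mul_pow, Real.sq_sqrt (Nat.cast_nonneg _)]
  field_simp

end IsDesignLaw

lemma isProbabilityMeasure_truncatedGaussian {σ τ : ℝ} (hσ : σ ≠ 0) (hτ : 0 < τ) :
    IsProbabilityMeasure (truncatedGaussian σ τ) := by
  have hvar : (σ ^ 2).toNNReal ≠ 0 := by
    rw [Ne, Real.toNNReal_eq_zero, not_le]
    positivity
  refine cond_isProbabilityMeasure fun hnull => ?_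
  have hvol : volume (Set.Icc (-τ) τ) = 0 := gaussianReal_absolutelyContinuous' 0 hvar hnull
  rw [Real.volume_Icc, ENNReal.ofReal_eq_zero] at hvol
  linarith

lemma ae_truncatedGaussian_abs_le (σ τ : ℝ) : ∀ᵐ x ∂(truncatedGaussian σ τ), |x| ≤ τ :=
  (ae_cond_mem measurableSet_Icc).mono fun _ hx => abs_le.mpr hx

section Lasso

open Matrix

variable {ι κ : Type*} [Fintype ι] [Fintype κ]

lemma abs_dotProduct_le_mul_sum_abs {u : κ → ℝ} {e : ℝ} (hu : ∀ j, |u j| ≤ e) (v : κ → ℝ) :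
    |u ⬝ᵥ v| ≤ e * ∑ j, |v j| :=
  calc |u ⬝ᵥ v| ≤ ∑ j, |u j * v j| := Finset.abs_sum_le_sum_abs _ _
    _ ≤ ∑ j, e * |v j| := Finset.sum_le_sum fun j _ => by
        rw [abs_mul]
        exact mul_le_mul_of_nonneg_right (hu j) (abs_nonneg _)
    _ = e * ∑ j, |v j| := (Finset.mul_sum _ _ _).symm

lemma abs_dotProduct_mulVec_le {E : Matrix ι κ ℝ} {e : ℝ} (hE : ∀ i j, |E i j| ≤ e)
    (u : ι → ℝ) (v : κ → ℝ) : |u ⬝ᵥ E *ᵥ v| ≤ e * (∑ j, |v j|) * ∑ i, |u i| := by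
  rw [dotProduct_comm]
  exact abs_dotProduct_le_mul_sum_abs (fun i => abs_dotProduct_le_mul_sum_abs (hE i) v) u

lemma sum_abs_le_sqrt_card_mul_sqrt_dotProduct_self (v : κ → ℝ) :
    ∑ j, |v j| ≤ √(Fintype.card κ) * √(v ⬝ᵥ v) := by
  rw [← Real.sqrt_mul (Nat.cast_nonneg _)]
  refine Real.le_sqrt_of_sq_le ((sq_sum_le_card_mul_sum_sq).trans_eq ?_)
  simp only [sq_abs, dotProduct, ← sq, Finset.card_univ]

lemma abs_dotProduct_le_sqrt_mul_sqrt (u v : κ → ℝ) : |u ⬝ᵥ v| ≤ √(u ⬝ᵥ u) * √(v ⬝ᵥ v) := by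
  rw [← Real.sqrt_mul (dotProduct_self_nonneg u)]
  refine Real.abs_le_sqrt ((Finset.sum_mul_sq_le_sq_mul_sq _ u v).trans_eq ?_)
  simp only [sq, dotProduct]

lemma dotProduct_transpose_mul_self_sub_one_mulVec [DecidableEq κ] (A : Matrix ι κ ℝ)
    (u v : κ → ℝ) : u ⬝ᵥ (Aᵀ * A - 1) *ᵥ v = (A *ᵥ u) ⬝ᵥ (A *ᵥ v) - u ⬝ᵥ v := by
  rw [sub_mulVec, one_mulVec, dotProduct_sub, ← mulVec_mulVec, dotProduct_mulVec, vecMul_transpose]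

lemma lasso_basic_inequality {A : Matrix ι κ ℝ} {y : ι → ℝ} {θ θ₀ : κ → ℝ} {n lam : ℝ}
    (hlam : 0 ≤ lam)
    (hopt : 1 / (2 * n) * ∑ i, ((A *ᵥ θ) i - y i) ^ 2 + lam * ∑ j, |θ j| ≤
      1 / (2 * n) * ∑ i, ((A *ᵥ θ₀) i - y i) ^ 2 + lam * ∑ j, |θ₀ j|) :
    1 / 2 * ((θ₀ - θ) ⬝ᵥ ((1 / n) • (Aᵀ * A)) *ᵥ (θ₀ - θ)) +
      ((1 / n) • (Aᵀ *ᵥ (y - A *ᵥ θ₀))) ⬝ᵥ (θ₀ - θ) ≤ lam * ∑ j, |(θ₀ - θ) j| := by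
  set h := θ₀ - θ
  set e := y - A *ᵥ θ₀ with he
  have hresidual : ∑ i, ((A *ᵥ θ) i - y i) ^ 2 =
      (A *ᵥ h) ⬝ᵥ (A *ᵥ h) + 2 * (e ⬝ᵥ (A *ᵥ h)) + e ⬝ᵥ e := by
    have hθ : A *ᵥ θ - y = -(A *ᵥ h + e) := by
      rw [mulVec_sub, he]
      abel
    calc ∑ i, ((A *ᵥ θ) i - y i) ^ 2 = (A *ᵥ θ - y) ⬝ᵥ (A *ᵥ θ - y) := by
          simp only [sq, dotProduct, Pi.sub_apply]
      _ = (A *ᵥ h) ⬝ᵥ (A *ᵥ h) + 2 * (e ⬝ᵥ (A *ᵥ h)) + e ⬝ᵥ e := by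
          rw [hθ, neg_dotProduct_neg]
          simp only [add_dotProduct, dotProduct_add, dotProduct_comm (A *ᵥ h) e]
          ring
  have hresidual₀ : ∑ i, ((A *ᵥ θ₀) i - y i) ^ 2 = e ⬝ᵥ e := by
    simp only [he, dotProduct, Pi.sub_apply]
    exact Finset.sum_congr rfl fun i _ => by ring
  have hl1 : ∑ j, |θ₀ j| - ∑ j, |θ j| ≤ ∑ j, |h j| := by
    rw [← Finset.sum_sub_distrib]
    exact Finset.sum_le_sum fun j _ => abs_sub_abs_le_abs_sub _ _
  have hpenalty := mul_le_mul_of_nonneg_left hl1 hlam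
  have hquad : h ⬝ᵥ ((1 / n) • (Aᵀ * A)) *ᵥ h = 1 / n * ((A *ᵥ h) ⬝ᵥ (A *ᵥ h)) := by
    rw [smul_mulVec, dotProduct_smul, ← mulVec_mulVec, dotProduct_mulVec, vecMul_transpose,
      smul_eq_mul]
  have hlin : ((1 / n) • (Aᵀ *ᵥ e)) ⬝ᵥ h = 1 / n * (e ⬝ᵥ (A *ᵥ h)) := by
    rw [smul_dotProduct, mulVec_transpose, ← dotProduct_mulVec, smul_eq_mul]
  have hhalf : 1 / (2 * n) = 1 / 2 * (1 / n) := (one_div_mul_one_div _ _).symm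
  rw [hresidual, hresidual₀, hhalf] at hopt
  rw [hquad, hlin]
  linarith

lemma dotProduct_mulVec_ge_of_gram_approx [DecidableEq κ] {S : Matrix κ κ ℝ} {v e : ℝ}
    (hS : ∀ j k, |(S - (1 + v) • (1 : Matrix κ κ ℝ)) j k| ≤ e) (he : 0 ≤ e)
    (hcard : Fintype.card κ * e ≤ 1 / 2) (h : κ → ℝ) :
    (1 / 2 + v) * (h ⬝ᵥ h) ≤ h ⬝ᵥ S *ᵥ h := by
  have hquad : |h ⬝ᵥ S *ᵥ h - (1 + v) * (h ⬝ᵥ h)| ≤ e * (∑ j, |h j|) * ∑ j, |h j| := by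
    have := abs_dotProduct_mulVec_le hS h h
    rwa [sub_mulVec, dotProduct_sub, smul_mulVec, one_mulVec, dotProduct_smul, smul_eq_mul] at this
  have herror : e * (∑ j, |h j|) * ∑ j, |h j| ≤ 1 / 2 * (h ⬝ᵥ h) :=
    calc e * (∑ j, |h j|) * ∑ j, |h j| = e * (∑ j, |h j|) ^ 2 := by ring
      _ ≤ e * (√(Fintype.card κ) * √(h ⬝ᵥ h)) ^ 2 := by
          gcongr
          exact sum_abs_le_sqrt_card_mul_sqrt_dotProduct_self h
      _ = Fintype.card κ * e * (h ⬝ᵥ h) := by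
          rw [mul_pow, Real.sq_sqrt (Nat.cast_nonneg _), Real.sq_sqrt (dotProduct_self_nonneg h)]
          ring
      _ ≤ 1 / 2 * (h ⬝ᵥ h) := mul_le_mul_of_nonneg_right hcard (dotProduct_self_nonneg h)
  linarith [(abs_le.mp hquad).1]

lemma sum_abs_le_of_basic_inequality [DecidableEq κ] {S : Matrix κ κ ℝ} {Z h θ₀ : κ → ℝ}
    {lam v e G : ℝ} (hS : ∀ j k, |(S - (1 + v) • (1 : Matrix κ κ ℝ)) j k| ≤ e)
    (hZ : ∀ j, |(Z + v • θ₀) j| ≤ G) (hθ₀ : θ₀ ⬝ᵥ θ₀ ≤ 1) (hv : 0 ≤ v) (hlam : 0 ≤ lam)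
    (he : 0 ≤ e) (hG : 0 ≤ G) (hcard : Fintype.card κ * e ≤ 1 / 2)
    (hbasic : 1 / 2 * (h ⬝ᵥ S *ᵥ h) + Z ⬝ᵥ h ≤ lam * ∑ j, |h j|) :
    ∑ j, |h j| ≤ 4 * (Fintype.card κ * (lam + G) + √(Fintype.card κ) * v) := by
  have hnorm : √(h ⬝ᵥ h) ^ 2 = h ⬝ᵥ h := Real.sq_sqrt (dotProduct_self_nonneg h)
  have hl1 := sum_abs_le_sqrt_card_mul_sqrt_dotProduct_self h
  have hquad := dotProduct_mulVec_ge_of_gram_approx hS he hcard h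
  set N := √(h ⬝ᵥ h)
  have hN : 0 ≤ N := Real.sqrt_nonneg _
  have hlin : -(G * ∑ j, |h j|) - v * N ≤ Z ⬝ᵥ h := by
    have hsplit : Z ⬝ᵥ h = (Z + v • θ₀) ⬝ᵥ h - v * (θ₀ ⬝ᵥ h) := by
      rw [add_dotProduct, smul_dotProduct, smul_eq_mul, add_sub_cancel_right]
    have hθ : θ₀ ⬝ᵥ h ≤ N := (le_abs_self _).trans <|
      (abs_dotProduct_le_sqrt_mul_sqrt θ₀ h).trans <|
        mul_le_of_le_one_left hN (Real.sqrt_le_one.mpr hθ₀)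
    linarith [(abs_le.mp (abs_dotProduct_le_mul_sum_abs hZ h)).1, mul_le_mul_of_nonneg_left hθ hv]
  have hN_le : N ≤ 4 * ((lam + G) * √(Fintype.card κ) + v) := by
    rcases hN.eq_or_lt with h0 | h0
    · rw [← h0]
      positivity
    · refine le_of_mul_le_mul_right ?_ h0
      nlinarith [mul_nonneg hv (sq_nonneg N),
        mul_le_mul_of_nonneg_left hl1 (add_nonneg hlam hG)]
  calc ∑ j, |h j| ≤ √(Fintype.card κ) * N := hl1
    _ ≤ √(Fintype.card κ) * (4 * ((lam + G) * √(Fintype.card κ) + v)) := by gcongr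
    _ = 4 * (√(Fintype.card κ) ^ 2 * (lam + G) + √(Fintype.card κ) * v) := by ring
    _ = 4 * (Fintype.card κ * (lam + G) + √(Fintype.card κ) * v) := by
        rw [Real.sq_sqrt (Nat.cast_nonneg _)]

end Lasso

lemma ApproxPreservesInner.abs_dotProduct_mulVec_le {ι κ : Type*} [Fintype ι] [Fintype κ]
    [DecidableEq κ] {A : Matrix ι κ ℝ} {e x y : ℝ} {u v : κ → ℝ} (h : ApproxPreservesInner A e u v)
    (he : 0 ≤ e) (hu : √(u ⬝ᵥ u) ≤ x) (hv : √(v ⬝ᵥ v) ≤ y) :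
    |u ⬝ᵥ ((A.transpose * A - 1).mulVec v)| ≤ e * (x * y) := by
  rw [dotProduct_transpose_mul_self_sub_one_mulVec]
  refine h.trans (mul_le_mul_of_nonneg_left ?_ he)
  exact mul_le_mul hu hv (Real.sqrt_nonneg _) ((Real.sqrt_nonneg _).trans hu)

lemma dotProduct_self_le_of_abs_le {ι : Type*} [Fintype ι] {u : ι → ℝ} {a : ℝ}
    (hu : ∀ i, |u i| ≤ a) : u ⬝ᵥ u ≤ Fintype.card ι * a ^ 2 := by
  refine (Finset.sum_le_sum fun i _ => ?_).trans_eq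
    (by rw [Finset.sum_const, Finset.card_univ, nsmul_eq_mul])
  rw [← sq]
  exact sq_le_sq.mpr ((hu i).trans (le_abs_self a))

namespace ParamTuple

open Matrix

variable {t : ParamTuple} (c : ModelConsts)

/-- The matrix `[X; w I; 0]`, of which `X*` is the projection. -/
noncomputable def Sample.stack (ω : t.Sample) : Matrix t.Cols (Fin t.p) ℝ :=
  fromRows ω.X (fromRows (t.w c • 1) 0)

/-- The noise `[ξ; 0; 0]`, as a vector that the projection acts on. -/
def Sample.liftedNoise (ω : t.Sample) : t.Cols → ℝ := Sum.elim ω.ξ 0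

/-- The vector `[0; -θ₀; 1]`. The privatization replaces the noise `[ξ; 0; 0]` of the regression
of `[y; 0; w]` on `[X; w I; 0]` by `[ξ; 0; 0] + w [0; -θ₀; 1]`. -/
def shift (θ₀ : Fin t.p → ℝ) : t.Cols → ℝ := Sum.elim 0 (Sum.elim (-θ₀) 1)

/-- The defect `Rᵀ R - I` of isometry of the projection. -/
def Sample.defect (ω : t.Sample) : Matrix t.Cols t.Cols ℝ := ω.Rᵀ * ω.R - 1

/-- The deviation `X*ᵀ X* / n - (1 + w² / n) I` of the private Gram matrix. -/
noncomputable def Sample.gramError (ω : t.Sample) : Matrix (Fin t.p) (Fin t.p) ℝ :=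
  (1 / (t.n : ℝ)) • (ω.Xᵀ * ω.X - (t.n : ℝ) • 1 + (ω.stack c)ᵀ * ω.defect * ω.stack c)

/-- The contribution of `w [0; -θ₀; 1]` to the bias. -/
noncomputable def Sample.shiftError (ω : t.Sample) (θ₀ : Fin t.p → ℝ) : Fin t.p → ℝ :=
  (t.w c / t.n) • (ω.stack c)ᵀ *ᵥ ω.defect *ᵥ shift θ₀

/-- The correlation of the private design with the projected noise. -/
noncomputable def Sample.noiseError (ω : t.Sample) : Fin t.p → ℝ :=
  (1 / (t.n : ℝ)) • (ω.Xᵀ *ᵥ ω.ξ + (ω.stack c)ᵀ *ᵥ ω.defect *ᵥ ω.liftedNoise)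

section Algebra

variable (ω : t.Sample) (θ₀ : Fin t.p → ℝ)

lemma Sample.privX_eq : ω.privX c θ₀ = ω.R * ω.stack c := by
  ext i j
  simp [privX, release, stack, mul_apply, Fintype.sum_sum_type, one_apply]

lemma Sample.privy_eq :
    ω.privy c θ₀ = ω.R *ᵥ (ω.stack c *ᵥ θ₀ + (ω.liftedNoise + t.w c • shift θ₀)) := by
  ext i
  simp [privy, release, stack, liftedNoise, shift, y, mul_apply, mulVec, dotProduct,
    Fintype.sum_sum_type, one_apply, mul_add, Finset.sum_add_distrib]
  ring

lemma Sample.transpose_stack_mul_stack :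
    (ω.stack c)ᵀ * ω.stack c = ω.Xᵀ * ω.X + t.w c ^ 2 • 1 := by
  simp [stack, transpose_fromRows, fromCols_mul_fromRows, smul_smul, sq]

lemma Sample.transpose_stack_mulVec_shift :
    (ω.stack c)ᵀ *ᵥ shift θ₀ = -(t.w c • θ₀) := by
  simp [stack, shift, transpose_fromRows, smul_mulVec]

lemma Sample.transpose_stack_mulVec_liftedNoise :
    (ω.stack c)ᵀ *ᵥ ω.liftedNoise = ω.Xᵀ *ᵥ ω.ξ := by
  simp [stack, liftedNoise, transpose_fromRows]

lemma Sample.gramError_eq (hn : 0 < t.n) :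
    ω.gramError c = (1 / (t.n : ℝ)) • ((ω.privX c θ₀)ᵀ * ω.privX c θ₀) -
      (1 + t.w c ^ 2 / t.n) • (1 : Matrix (Fin t.p) (Fin t.p) ℝ) := by
  have : (t.n : ℝ) ≠ 0 := Nat.cast_ne_zero.mpr hn.ne'
  have hdefect : (ω.stack c)ᵀ * ω.defect * ω.stack c =
      (ω.privX c θ₀)ᵀ * ω.privX c θ₀ - (ω.Xᵀ * ω.X + t.w c ^ 2 • 1) := by
    rw [← transpose_stack_mul_stack, privX_eq, defect, transpose_mul]
    simp only [Matrix.mul_sub, Matrix.sub_mul, Matrix.mul_one, Matrix.mul_assoc]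
  rw [gramError, hdefect]
  match_scalars <;> field_simp <;> ring

lemma Sample.noiseError_add_shiftError_eq :
    ω.noiseError c + ω.shiftError c θ₀ =
      (1 / (t.n : ℝ)) • ((ω.privX c θ₀)ᵀ *ᵥ (ω.privy c θ₀ - ω.privX c θ₀ *ᵥ θ₀)) +
        (t.w c ^ 2 / t.n) • θ₀ := by
  have hresidual : ω.privy c θ₀ - ω.privX c θ₀ *ᵥ θ₀ =
      ω.R *ᵥ (ω.liftedNoise + t.w c • shift θ₀) := by
    rw [privy_eq, privX_eq, ← mulVec_mulVec, mulVec_add, add_sub_cancel_left]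
  have hdefect (v : t.Cols → ℝ) : (ω.stack c)ᵀ *ᵥ ω.defect *ᵥ v =
      (ω.privX c θ₀)ᵀ *ᵥ ω.R *ᵥ v - (ω.stack c)ᵀ *ᵥ v := by
    rw [privX_eq, defect, transpose_mul, sub_mulVec, mulVec_sub, one_mulVec]
    simp only [mulVec_mulVec, Matrix.mul_assoc]
  rw [noiseError, shiftError, hresidual, hdefect, hdefect, transpose_stack_mulVec_shift,
    transpose_stack_mulVec_liftedNoise]
  ext j
  simp only [mulVec_add, mulVec_smul, Pi.add_apply, Pi.sub_apply, Pi.smul_apply, Pi.neg_apply,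
    smul_eq_mul]
  ring

lemma Sample.bias_eq (hn : 0 < t.n) (θ : Fin t.p → ℝ) :
    ω.bias c θ₀ θ = ω.gramError c *ᵥ (θ₀ - θ) + ω.shiftError c θ₀ := by
  have : (t.n : ℝ) ≠ 0 := Nat.cast_ne_zero.mpr hn.ne'
  have hstack : fromCols ω.Xᵀ (fromCols (t.w c • (1 : Matrix (Fin t.p) (Fin t.p) ℝ))
      (0 : Matrix (Fin t.p) Unit ℝ)) = (ω.stack c)ᵀ := by
    simp [stack, transpose_fromRows]
  have hvector : Sum.elim (ω.X *ᵥ (θ₀ - θ)) (Sum.elim (-(t.w c • θ)) fun _ => t.w c) =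
      ω.stack c *ᵥ (θ₀ - θ) + t.w c • shift θ₀ := by
    ext (i | j | u)
    · simp [stack, shift]
    · simp [stack, shift, smul_mulVec]
      ring
    · simp [stack, shift]
  have hgram : (1 / (t.n : ℝ)) • (ω.Xᵀ * ω.X) - 1 =
      (1 / (t.n : ℝ)) • (ω.Xᵀ * ω.X - (t.n : ℝ) • (1 : Matrix (Fin t.p) (Fin t.p) ℝ)) := by
    rw [smul_sub, smul_smul, one_div_mul_cancel this, one_smul]
  rw [bias, hstack, hvector, hgram, gramError, shiftError, smul_add, add_mulVec]
  simp only [mulVec_add, mulVec_smul, ← mulVec_mulVec, smul_mulVec, smul_add, smul_smul]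
  rw [add_assoc, one_div_mul_eq_div]
  rfl

end Algebra

end ParamTuple

namespace ParamTuple

open Matrix

variable {t : ParamTuple} (c : ModelConsts)

/-- The typical samples: the data are bounded, and at level `L` the empirical Gram matrix and noise
correlations concentrate and the projection preserves the inner products that enter the bias. -/
structure Sample.Regular (θ₀ : Fin t.p → ℝ) (L : ℝ) (ω : t.Sample) : Prop where
  abs_X_le : ∀ i j, |ω.X i j| ≤ c.b
  abs_ξ_le : ∀ i, |ω.ξ i| ≤ c.τ
  gram : ∀ j k, |(ω.Xᵀ * ω.X - (t.n : ℝ) • (1 : Matrix (Fin t.p) (Fin t.p) ℝ)) j k| ≤ √t.n * L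
  correlation : ∀ j, |(ω.Xᵀ *ᵥ ω.ξ) j| ≤ √t.n * L * c.τ
  inner_col : ∀ j k,
    ApproxPreservesInner ω.R (L / √t.r) ((ω.stack c).col j) ((ω.stack c).col k)
  inner_shift : ∀ j, ApproxPreservesInner ω.R (L / √t.r) ((ω.stack c).col j) (shift θ₀)
  inner_noise : ∀ j, ApproxPreservesInner ω.R (L / √t.r) ((ω.stack c).col j) ω.liftedNoise

variable (t) in
/-- Bound on the entries of `Sample.gramError` for samples that are regular at level `L`. -/
noncomputable def gramBound (L : ℝ) : ℝ := L / √t.n + L / √t.r * (c.b ^ 2 + 1)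

variable (t) in
/-- Bound on the entries of `Sample.shiftError` for samples that are regular at level `L`. -/
noncomputable def shiftBound (L : ℝ) : ℝ := L / √t.r * √(c.b ^ 2 + 1) * √2 * (t.w c / √t.n)

variable (t) in
/-- Bound on the entries of `Sample.noiseError` for samples that are regular at level `L`. -/
noncomputable def noiseBound (L : ℝ) : ℝ := L / √t.n * c.τ + L / √t.r * √(c.b ^ 2 + 1) * c.τ

variable (t) in
/-- Bound on the `ℓ¹` error of the private Lasso for samples that are regular at level `L`. -/
noncomputable def l1Bound (C L : ℝ) : ℝ :=
  4 * (t.p * (t.penalty c C + (t.noiseBound c L + t.shiftBound c L)) + √t.p * (t.w c ^ 2 / t.n))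

variable (t) in
/-- Bound on the entries of the bias for samples that are regular at level `L`. -/
noncomputable def biasBound (C L : ℝ) : ℝ := t.gramBound c L * t.l1Bound c C L + t.shiftBound c L

lemma w_nonneg : 0 ≤ t.w c := Real.sqrt_nonneg _

lemma sqrt_shift_dotProduct_self_le {θ₀ : Fin t.p → ℝ} (hθ₀ : θ₀ ⬝ᵥ θ₀ ≤ 1) :
    √((shift θ₀ : t.Cols → ℝ) ⬝ᵥ shift θ₀) ≤ √2 := by
  refine Real.sqrt_le_sqrt ?_
  simp only [shift, sumElim_dotProduct_sumElim, neg_dotProduct_neg, zero_dotProduct]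
  simp only [dotProduct_one, Pi.one_apply, Finset.univ_unique, Finset.sum_singleton]
  linarith

namespace Sample.Regular

variable {c} {ω : t.Sample} {θ₀ θ : Fin t.p → ℝ} {C L : ℝ}

lemma sqrt_col_dotProduct_self_le (hω : ω.Regular c θ₀ L) (hw : t.w c ^ 2 ≤ t.n) (j : Fin t.p) :
    √((ω.stack c).col j ⬝ᵥ (ω.stack c).col j) ≤ √t.n * √(c.b ^ 2 + 1) := by
  rw [← Real.sqrt_mul (Nat.cast_nonneg _)]
  refine Real.sqrt_le_sqrt ?_
  have hcol : (ω.stack c).col j ⬝ᵥ (ω.stack c).col j =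
      ω.X.col j ⬝ᵥ ω.X.col j + t.w c ^ 2 := by
    simpa [mul_apply, dotProduct] using congrFun₂ (ω.transpose_stack_mul_stack c) j j
  have hX := dotProduct_self_le_of_abs_le (u := ω.X.col j) fun i => hω.abs_X_le i j
  rw [Fintype.card_fin] at hX
  linarith

lemma sqrt_liftedNoise_dotProduct_self_le (hω : ω.Regular c θ₀ L) (hτ : 0 ≤ c.τ) :
    √(ω.liftedNoise ⬝ᵥ ω.liftedNoise) ≤ √t.n * c.τ := by
  have hξ := dotProduct_self_le_of_abs_le hω.abs_ξ_le
  rw [Fintype.card_fin] at hξ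
  rw [← Real.sqrt_sq hτ, ← Real.sqrt_mul (Nat.cast_nonneg _)]
  refine Real.sqrt_le_sqrt ?_
  simpa [Sample.liftedNoise, sumElim_dotProduct_sumElim] using hξ

lemma abs_gramError_le (hω : ω.Regular c θ₀ L) (hn : 0 < t.n) (hL : 0 ≤ L)
    (hw : t.w c ^ 2 ≤ t.n) (j k : Fin t.p) : |ω.gramError c j k| ≤ t.gramBound c L := by
  have hn' : (0 : ℝ) < t.n := Nat.cast_pos.mpr hn
  have hproj : |((ω.stack c)ᵀ * ω.defect * ω.stack c) j k| ≤
      L / √t.r * (√t.n * √(c.b ^ 2 + 1) * (√t.n * √(c.b ^ 2 + 1))) := by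
    rw [Matrix.mul_assoc]
    exact (hω.inner_col j k).abs_dotProduct_mulVec_le (by positivity)
      (hω.sqrt_col_dotProduct_self_le hw j) (hω.sqrt_col_dotProduct_self_le hw k)
  rw [gramError, Matrix.smul_apply, Matrix.add_apply, smul_eq_mul, abs_mul,
    abs_of_pos (one_div_pos.mpr hn')]
  calc 1 / (t.n : ℝ) * |(ω.Xᵀ * ω.X - (t.n : ℝ) • (1 : Matrix (Fin t.p) (Fin t.p) ℝ)) j k +
          ((ω.stack c)ᵀ * ω.defect * ω.stack c) j k|
      ≤ 1 / (t.n : ℝ) * (√t.n * L +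
          L / √t.r * (√t.n * √(c.b ^ 2 + 1) * (√t.n * √(c.b ^ 2 + 1)))) := by
        gcongr
        exact (abs_add_le _ _).trans (add_le_add (hω.gram j k) hproj)
    _ = √t.n / t.n * L + √t.n ^ 2 / t.n * (L / √t.r * √(c.b ^ 2 + 1) ^ 2) := by ring
    _ = t.gramBound c L := by
        rw [Real.sq_sqrt hn'.le, Real.sq_sqrt (by positivity), Real.sqrt_div_self',
          div_self hn'.ne', gramBound]
        ring

lemma abs_shiftError_le (hω : ω.Regular c θ₀ L) (hL : 0 ≤ L)
    (hw : t.w c ^ 2 ≤ t.n) (hθ₀ : θ₀ ⬝ᵥ θ₀ ≤ 1) (j : Fin t.p) :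
    |ω.shiftError c θ₀ j| ≤ t.shiftBound c L := by
  have hw0 : 0 ≤ t.w c / t.n := div_nonneg (w_nonneg c) (Nat.cast_nonneg _)
  rw [shiftError, Pi.smul_apply, smul_eq_mul, abs_mul, abs_of_nonneg hw0]
  calc t.w c / t.n * |((ω.stack c)ᵀ *ᵥ ω.defect *ᵥ shift θ₀) j|
      ≤ t.w c / t.n * (L / √t.r * (√t.n * √(c.b ^ 2 + 1) * √2)) :=
        mul_le_mul_of_nonneg_left ((hω.inner_shift j).abs_dotProduct_mulVec_le (by positivity)
          (hω.sqrt_col_dotProduct_self_le hw j) (sqrt_shift_dotProduct_self_le hθ₀)) hw0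
    _ = √t.n / t.n * (L / √t.r * √(c.b ^ 2 + 1) * √2 * t.w c) := by ring
    _ = t.shiftBound c L := by
        rw [Real.sqrt_div_self', shiftBound]
        ring

lemma abs_noiseError_le (hω : ω.Regular c θ₀ L) (hn : 0 < t.n) (hL : 0 ≤ L)
    (hw : t.w c ^ 2 ≤ t.n) (hτ : 0 ≤ c.τ) (j : Fin t.p) :
    |ω.noiseError c j| ≤ t.noiseBound c L := by
  have hn' : (0 : ℝ) < t.n := Nat.cast_pos.mpr hn
  have hproj : |((ω.stack c)ᵀ *ᵥ ω.defect *ᵥ ω.liftedNoise) j| ≤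
      L / √t.r * (√t.n * √(c.b ^ 2 + 1) * (√t.n * c.τ)) :=
    (hω.inner_noise j).abs_dotProduct_mulVec_le (by positivity)
      (hω.sqrt_col_dotProduct_self_le hw j) (hω.sqrt_liftedNoise_dotProduct_self_le hτ)
  rw [noiseError, Pi.smul_apply, Pi.add_apply, smul_eq_mul, abs_mul,
    abs_of_pos (one_div_pos.mpr hn')]
  calc 1 / (t.n : ℝ) * |(ω.Xᵀ *ᵥ ω.ξ) j + ((ω.stack c)ᵀ *ᵥ ω.defect *ᵥ ω.liftedNoise) j|
      ≤ 1 / (t.n : ℝ) * (√t.n * L * c.τ +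
          L / √t.r * (√t.n * √(c.b ^ 2 + 1) * (√t.n * c.τ))) := by
        gcongr
        exact (abs_add_le _ _).trans (add_le_add (hω.correlation j) hproj)
    _ = √t.n / t.n * (L * c.τ) + √t.n ^ 2 / t.n * (L / √t.r * √(c.b ^ 2 + 1) * c.τ) := by ring
    _ = t.noiseBound c L := by
        rw [Real.sq_sqrt hn'.le, Real.sqrt_div_self', div_self hn'.ne', noiseBound]
        ring

lemma sum_abs_sub_le_l1Bound (hω : ω.Regular c θ₀ L) (hθ : ω.IsLasso c θ₀ C θ)
    (hpenalty : 0 ≤ t.penalty c C) (hn : 0 < t.n) (hL : 0 ≤ L) (hτ : 0 ≤ c.τ)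
    (hw : t.w c ^ 2 ≤ t.n) (hθ₀ : θ₀ ⬝ᵥ θ₀ ≤ 1) (hgram : t.p * t.gramBound c L ≤ 1 / 2) :
    ∑ j, |(θ₀ - θ) j| ≤ t.l1Bound c C L := by
  have hv : 0 ≤ t.w c ^ 2 / t.n := by positivity
  have hgram0 : 0 ≤ t.gramBound c L := by
    unfold gramBound
    positivity
  have hscore0 : 0 ≤ t.noiseBound c L + t.shiftBound c L := by
    have := t.w_nonneg c
    unfold noiseBound shiftBound
    positivity
  have hscore (j : Fin t.p) : |((1 / (t.n : ℝ)) • ((ω.privX c θ₀)ᵀ *ᵥ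
      (ω.privy c θ₀ - ω.privX c θ₀ *ᵥ θ₀)) + (t.w c ^ 2 / t.n) • θ₀) j| ≤
        t.noiseBound c L + t.shiftBound c L := by
    rw [← noiseError_add_shiftError_eq, Pi.add_apply]
    exact (abs_add_le _ _).trans (add_le_add (hω.abs_noiseError_le hn hL hw hτ j)
      (hω.abs_shiftError_le hL hw hθ₀ j))
  have hGram (j k : Fin t.p) := hω.abs_gramError_le hn hL hw j k
  simp only [gramError_eq c ω θ₀ hn] at hGram
  have h := sum_abs_le_of_basic_inequality hGram hscore hθ₀ hv hpenalty hgram0 hscore0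
    (by rwa [Fintype.card_fin]) (lasso_basic_inequality hpenalty (hθ θ₀))
  rwa [Fintype.card_fin] at h

lemma norm_bias_le_biasBound (hω : ω.Regular c θ₀ L) (hθ : ω.IsLasso c θ₀ C θ)
    (hpenalty : 0 ≤ t.penalty c C) (hn : 0 < t.n) (hL : 0 ≤ L) (hτ : 0 ≤ c.τ)
    (hw : t.w c ^ 2 ≤ t.n) (hθ₀ : θ₀ ⬝ᵥ θ₀ ≤ 1) (hgram : t.p * t.gramBound c L ≤ 1 / 2) :
    ‖ω.bias c θ₀ θ‖ ≤ t.biasBound c C L := by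
  have hl1 := hω.sum_abs_sub_le_l1Bound hθ hpenalty hn hL hτ hw hθ₀ hgram
  have hl1_nonneg : 0 ≤ t.l1Bound c C L :=
    (Finset.sum_nonneg fun _ _ => abs_nonneg _).trans hl1
  have hgram0 : 0 ≤ t.gramBound c L := by
    unfold gramBound
    positivity
  have hshift0 : 0 ≤ t.shiftBound c L := by
    have := t.w_nonneg c
    unfold shiftBound
    positivity
  rw [biasBound, pi_norm_le_iff_of_nonneg (add_nonneg (mul_nonneg hgram0 hl1_nonneg) hshift0)]
  intro j
  rw [bias_eq c ω θ₀ hn, Pi.add_apply, Real.norm_eq_abs]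
  refine (abs_add_le _ _).trans (add_le_add ?_ (hω.abs_shiftError_le hL hw hθ₀ j))
  exact (abs_dotProduct_le_mul_sum_abs (hω.abs_gramError_le hn hL hw j) (θ₀ - θ)).trans
    (mul_le_mul_of_nonneg_left hl1 hgram0)

end Sample.Regular

end ParamTuple

section TypicalSamples

open Matrix

lemma measurableSet_approxPreservesInner {Ω ι κ : Type*} [MeasurableSpace Ω] [Fintype ι]
    [Fintype κ] {A : Ω → Matrix ι κ ℝ} {u v : Ω → κ → ℝ} (e : ℝ)
    (hA : ∀ i k, Measurable fun ω => A ω i k) (hu : Measurable u) (hv : Measurable v) :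
    MeasurableSet {ω | ApproxPreservesInner (A ω) e (u ω) (v ω)} := by
  unfold ApproxPreservesInner mulVec dotProduct
  exact measurableSet_le (by fun_prop) (by fun_prop)

lemma exp_neg_sq_div_le_of_le {x y : ℝ} (hx : 0 < x) (hxy : x ≤ y) {L : ℝ} :
    Real.exp (-L ^ 2 / x) ≤ Real.exp (-L ^ 2 / y) := by
  rw [neg_div, neg_div]
  gcongr

namespace ParamTuple

variable {t : ParamTuple} {c : ModelConsts} {D : Measure ℝ}

lemma Sample.measurable_stack_col (j : Fin t.p) :
    Measurable fun ω : t.Sample => (ω.stack c).col j := by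
  refine measurable_pi_iff.mpr ?_
  rintro (i | k | u) <;> simp only [stack, X, col_apply, fromRows_apply_inl, fromRows_apply_inr] <;>
    fun_prop

lemma Sample.measurable_liftedNoise : Measurable (liftedNoise : t.Sample → t.Cols → ℝ) := by
  refine measurable_pi_iff.mpr ?_
  rintro (i | k) <;> simp only [liftedNoise, ξ, Sum.elim_inl, Sum.elim_inr] <;> fun_prop

instance [IsProbabilityMeasure D] [IsProbabilityMeasure (truncatedGaussian c.σ c.τ)] :
    IsProbabilityMeasure (t.sampleLaw c D) := by
  unfold sampleLaw
  infer_instance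

lemma sampleLaw_inner_deviation [IsProbabilityMeasure D]
    [IsProbabilityMeasure (truncatedGaussian c.σ c.τ)] (hr : 0 < t.r) {L : ℝ} (hL : 0 ≤ L)
    (hLr : L ≤ √t.r) {u v : (Fin t.n → Fin t.p → ℝ) → (Fin t.n → ℝ) → t.Cols → ℝ}
    (hu : Measurable fun ω : t.Sample => u ω.1 ω.2.1)
    (hv : Measurable fun ω : t.Sample => v ω.1 ω.2.1) :
    (t.sampleLaw c D).real
        {ω | ¬ ApproxPreservesInner ω.R (L / √t.r) (u ω.1 ω.2.1) (v ω.1 ω.2.1)} ≤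
      4 * Real.exp (-L ^ 2 / 16) := by
  have : Nonempty (Fin t.r) := ⟨⟨0, hr⟩⟩
  have hr' : (0 : ℝ) < t.r := Nat.cast_pos.mpr hr
  have hS := (measurableSet_approxPreservesInner (A := fun ω : t.Sample => ω.R) (L / √t.r)
    (fun i k => by unfold Sample.R; fun_prop) hu hv).compl
  have hexp : -(t.r * (L / √t.r) ^ 2) / 16 = -L ^ 2 / 16 := by
    rw [div_pow, Real.sq_sqrt hr'.le, mul_div_cancel₀ _ hr'.ne']
  have hdev (x : Fin t.n → Fin t.p → ℝ) (ξ : Fin t.n → ℝ) :=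
    gaussianProjection_inner_deviation (ι := Fin t.r) (u x ξ) (v x ξ)
      (div_nonneg hL (Real.sqrt_nonneg _)) ((div_le_one (Real.sqrt_pos.mpr hr')).mpr hLr)
  simp only [gaussianProjection, Fintype.card_fin, hexp] at hdev
  exact measureReal_prod_le_of_ae_fst hS <| ae_of_all _ fun x =>
    measureReal_prod_le_of_ae_fst (measurable_prodMk_left hS) <| ae_of_all _ fun ξ => hdev x ξ

lemma sampleLaw_gram_deviation (hD : IsDesignLaw D c.b)
    [IsProbabilityMeasure (truncatedGaussian c.σ c.τ)] (hn : 0 < t.n) {L : ℝ} (hL : 0 ≤ L)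
    (j k : Fin t.p) :
    (t.sampleLaw c D).real {ω | ¬ |(ω.Xᵀ * ω.X -
        (t.n : ℝ) • (1 : Matrix (Fin t.p) (Fin t.p) ℝ)) j k| ≤ √t.n * L} ≤
      2 * Real.exp (-L ^ 2 / (2 * (c.b ^ 2 + 1) ^ 2)) := by
  have := hD.1
  have : Nonempty (Fin t.n) := ⟨⟨0, hn⟩⟩
  have hdev := hD.gram_deviation (ι := Fin t.n) j k hL
  rw [Fintype.card_fin] at hdev
  have hmeas : Measurable fun ω : t.Sample =>
      |(ω.Xᵀ * ω.X - (t.n : ℝ) • (1 : Matrix (Fin t.p) (Fin t.p) ℝ)) j k| := by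
    simp only [Sample.X, Matrix.sub_apply, Matrix.smul_apply, mul_apply, transpose_apply, of_apply]
    fun_prop
  exact measureReal_prod_le_of_ae_snd (measurableSet_le hmeas measurable_const).compl
    (ae_of_all _ fun _ => hdev)

lemma sampleLaw_correlation_deviation (hD : IsDesignLaw D c.b)
    [IsProbabilityMeasure (truncatedGaussian c.σ c.τ)] (hτ : 0 < c.τ) (hn : 0 < t.n) {L : ℝ}
    (hL : 0 ≤ L) (j : Fin t.p) :
    (t.sampleLaw c D).real {ω | ¬ |(ω.Xᵀ *ᵥ ω.ξ) j| ≤ √t.n * L * c.τ} ≤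
      2 * Real.exp (-L ^ 2 / (2 * c.b ^ 2)) := by
  have := hD.1
  have : Nonempty (Fin t.n) := ⟨⟨0, hn⟩⟩
  have hmeas : Measurable fun ω : t.Sample => |(ω.Xᵀ *ᵥ ω.ξ) j| := by
    simp only [Sample.X, Sample.ξ, mulVec, dotProduct, transpose_apply, of_apply]
    fun_prop
  have hξ : ∀ᵐ ξ ∂(Measure.pi fun _ : Fin t.n => truncatedGaussian c.σ c.τ), ∀ i, |ξ i| ≤ c.τ :=
    ae_pi_forall (ae_truncatedGaussian_abs_le c.σ c.τ)
  refine measureReal_prod_le_of_ae_snd (measurableSet_le hmeas measurable_const).compl ?_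
  filter_upwards [Measure.quasiMeasurePreserving_fst.ae hξ] with y hy
  have hdev := hD.correlation_deviation (ι := Fin t.n) hτ hy j hL
  rwa [Fintype.card_fin] at hdev

lemma sampleLaw_not_inner_le [IsProbabilityMeasure D]
    [IsProbabilityMeasure (truncatedGaussian c.σ c.τ)] (hr : 0 < t.r) {L : ℝ} (hL : 0 ≤ L)
    (hLr : L ≤ √t.r) (θ₀ : Fin t.p → ℝ) :
    (t.sampleLaw c D).real {ω | ¬ ((∀ j k, ApproxPreservesInner ω.R (L / √t.r)
          ((ω.stack c).col j) ((ω.stack c).col k)) ∧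
        (∀ j, ApproxPreservesInner ω.R (L / √t.r) ((ω.stack c).col j) (shift θ₀)) ∧
        ∀ j, ApproxPreservesInner ω.R (L / √t.r) ((ω.stack c).col j) ω.liftedNoise)} ≤
      (t.p ^ 2 + 2 * t.p) * (4 * Real.exp (-L ^ 2 / 16)) := by
  have hcol (j : Fin t.p) {v : (Fin t.n → Fin t.p → ℝ) → (Fin t.n → ℝ) → t.Cols → ℝ}
      (hv : Measurable fun ω : t.Sample => v ω.1 ω.2.1) :=
    sampleLaw_inner_deviation (D := D) (c := c) hr hL hLr
      (u := fun x ξ => (Sample.stack c (x, ξ, 0)).col j) (Sample.measurable_stack_col j) hv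
  have hinner_col := measureReal_not_forall_le fun j => measureReal_not_forall_le fun k =>
    hcol j (v := fun x ξ => (Sample.stack c (x, ξ, 0)).col k) (Sample.measurable_stack_col k)
  have hinner_shift := measureReal_not_forall_le fun j =>
    hcol j (v := fun _ _ => shift θ₀) measurable_const
  have hinner_noise := measureReal_not_forall_le fun j =>
    hcol j (v := fun x ξ => Sample.liftedNoise (x, ξ, 0)) Sample.measurable_liftedNoise
  refine (measureReal_not_and_le hinner_col
    (measureReal_not_and_le hinner_shift hinner_noise)).trans_eq ?_
  rw [Fintype.card_fin]
  ring

lemma sampleLaw_not_regular_le (hD : IsDesignLaw D c.b) (hσ : 0 < c.σ)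
    (hτ : 0 < c.τ) (hn : 0 < t.n) (hr : 0 < t.r) {L : ℝ} (hL : 0 ≤ L) (hLr : L ≤ √t.r)
    (θ₀ : Fin t.p → ℝ) :
    (t.sampleLaw c D).real {ω | ¬ ω.Regular c θ₀ L} ≤
      20 * t.p ^ 2 * Real.exp (-L ^ 2 / (16 * (c.b ^ 2 + 1) ^ 2)) := by
  have := hD.1
  have := isProbabilityMeasure_truncatedGaussian hσ.ne' hτ
  have hX : ∀ᵐ ω ∂(t.sampleLaw c D), ∀ i j, |ω.X i j| ≤ c.b :=
    Measure.quasiMeasurePreserving_fst.ae (ae_pi_forall hD.ae_pi_abs_le)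
  have hξ : ∀ᵐ ω ∂(t.sampleLaw c D), ∀ i, |ω.ξ i| ≤ c.τ :=
    Measure.quasiMeasurePreserving_snd.ae <| Measure.quasiMeasurePreserving_fst.ae <|
      ae_pi_forall (ae_truncatedGaussian_abs_le c.σ c.τ)
  have hgram := measureReal_not_forall_le fun j => measureReal_not_forall_le fun k =>
    sampleLaw_gram_deviation hD hn hL j k
  have hcorrelation := measureReal_not_forall_le fun j =>
    sampleLaw_correlation_deviation hD hτ hn hL j
  have hunion := measureReal_not_and_le (measureReal_not_nonpos_of_ae hX) <|
    measureReal_not_and_le (measureReal_not_nonpos_of_ae hξ) <|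
    measureReal_not_and_le hgram <| measureReal_not_and_le hcorrelation <|
    sampleLaw_not_inner_le hr hL hLr θ₀
  refine ((measureReal_mono ?_).trans hunion).trans ?_
  · rintro ω hω ⟨hX, hξ, hgram, hcorrelation, hcol, hshift, hnoise⟩
    exact hω ⟨hX, hξ, hgram, hcorrelation, hcol, hshift, hnoise⟩
  set q := Real.exp (-L ^ 2 / (16 * (c.b ^ 2 + 1) ^ 2))
  have hb := hD.one_le_sq
  have hq1 : Real.exp (-L ^ 2 / (2 * (c.b ^ 2 + 1) ^ 2)) ≤ q :=
    exp_neg_sq_div_le_of_le (by positivity) (by nlinarith)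
  have hq2 : Real.exp (-L ^ 2 / (2 * c.b ^ 2)) ≤ q :=
    exp_neg_sq_div_le_of_le (by positivity) (by nlinarith)
  have hq3 : Real.exp (-L ^ 2 / 16) ≤ q :=
    exp_neg_sq_div_le_of_le (by norm_num) (by nlinarith)
  have hp : (t.p : ℝ) ≤ t.p ^ 2 := mod_cast Nat.le_self_pow two_ne_zero t.p
  simp only [Fintype.card_fin, zero_add]
  calc _ ≤ t.p * (t.p * (2 * q)) + (t.p * (2 * q) + (t.p ^ 2 + 2 * t.p) * (4 * q)) := by
        gcongr
    _ = (6 * t.p ^ 2 + 10 * t.p) * q := by ring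
    _ ≤ 20 * t.p ^ 2 * q := by
        gcongr
        nlinarith

end ParamTuple

end TypicalSamples

section PolynomialGrowth

/-- `f p = O(p ^ a')` for every `a' > a`, that is, `f p` is at most `p ^ (a + o(1))`. Constants and
powers of `log p` have growth exponent `0`. -/
def PolyGrowth (f : ℕ → ℝ) (a : ℝ) : Prop :=
  ∀ a' > a, f =O[atTop] fun p : ℕ => (p : ℝ) ^ a'

/-- `|f p| = p ^ (a + o(1))`: two-sided version of `PolyGrowth`, needed for denominators. -/
structure PolyOrder (f : ℕ → ℝ) (a : ℝ) : Prop where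
  growth : PolyGrowth f a
  rpow_isBigO : ∀ a' < a, (fun p : ℕ => (p : ℝ) ^ a') =O[atTop] f

lemma natCast_rpow_isBigO_natCast_rpow {a a' : ℝ} (h : a ≤ a') :
    (fun p : ℕ => (p : ℝ) ^ a) =O[atTop] fun p : ℕ => (p : ℝ) ^ a' := by
  refine IsBigO.of_norm_eventuallyLE ?_
  filter_upwards [eventually_ge_atTop 1] with p hp
  have hp' : (1 : ℝ) ≤ p := Nat.one_le_cast.mpr hp
  rw [Real.norm_of_nonneg (by positivity)]
  exact Real.rpow_le_rpow_of_exponent_le hp' h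

lemma sqrt_natCast_rpow_two_mul (p : ℕ) (x : ℝ) : √((p : ℝ) ^ (2 * x)) = (p : ℝ) ^ x := by
  rw [mul_comm, Real.rpow_mul (Nat.cast_nonneg p), Real.rpow_two, Real.sqrt_sq (by positivity)]

namespace PolyGrowth

variable {f g : ℕ → ℝ} {a a' k η : ℝ}

lemma mono (hf : PolyGrowth f a) (h : a ≤ a') : PolyGrowth f a' :=
  fun _ hx => hf _ (h.trans_lt hx)

lemma of_isBigO (h : f =O[atTop] g) (hg : PolyGrowth g a) : PolyGrowth f a :=
  fun x hx => h.trans (hg x hx)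

lemma of_isBigO_rpow (h : f =O[atTop] fun p : ℕ => (p : ℝ) ^ a) : PolyGrowth f a :=
  fun _ hx => h.trans (natCast_rpow_isBigO_natCast_rpow hx.le)

lemma of_eventually_le (hg : PolyGrowth g a) (h0 : ∀ᶠ p in atTop, 0 ≤ f p)
    (h : ∀ᶠ p in atTop, f p ≤ g p) : PolyGrowth f a := by
  refine of_isBigO (IsBigO.of_norm_eventuallyLE ?_) hg
  filter_upwards [h0, h] with p hp0 hp
  rwa [Real.norm_of_nonneg hp0]

lemma const (k : ℝ) : PolyGrowth (fun _ => k) 0 :=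
  of_isBigO_rpow (by simpa using isBigO_const_const k (one_ne_zero (α := ℝ)) (atTop : Filter ℕ))

lemma natCast : PolyGrowth (fun p => (p : ℝ)) 1 :=
  of_isBigO_rpow (by simpa using isBigO_refl _ _)

lemma log_natCast : PolyGrowth (fun p => Real.log p) 0 :=
  fun _ hx => ((isLittleO_log_rpow_atTop hx).comp_tendsto tendsto_natCast_atTop_atTop).isBigO

lemma mul (hf : PolyGrowth f a) (hg : PolyGrowth g a') :
    PolyGrowth (fun p => f p * g p) (a + a') := by
  intro x hx
  exact IsBigO.mul_atTop_rpow_natCast_of_isBigO_rpow (a + (x - (a + a')) / 2)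
    (a' + (x - (a + a')) / 2) x (hf _ (by linarith)) (hg _ (by linarith)) (by linarith)

lemma add (hf : PolyGrowth f a) (hg : PolyGrowth g a) : PolyGrowth (fun p => f p + g p) a :=
  fun x hx => (hf x hx).add (hg x hx)

lemma max (hf : PolyGrowth f a) (hg : PolyGrowth g a) :
    PolyGrowth (fun p => Max.max (f p) (g p)) a := by
  intro x hx
  refine (IsBigO.of_norm_le fun p => ?_).trans ((hf x hx).norm_left.add (hg x hx).norm_left)
  exact abs_max_le_max_abs_abs.trans (max_le_add_of_nonneg (abs_nonneg _) (abs_nonneg _))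

lemma const_mul (k : ℝ) (hf : PolyGrowth f a) : PolyGrowth (fun p => k * f p) a :=
  fun x hx => (hf x hx).const_mul_left k

lemma sq (hf : PolyGrowth f a) : PolyGrowth (fun p => f p ^ 2) (2 * a) := by
  simpa only [_root_.sq, two_mul] using hf.mul hf

lemma sqrt (hf : PolyGrowth f a) : PolyGrowth (fun p => √(f p)) (a / 2) := by
  intro x hx
  simpa only [sqrt_natCast_rpow_two_mul] using (hf (2 * x) (by linarith)).sqrt
    (Eventually.of_forall fun p => by positivity)

lemma div (hf : PolyGrowth f a) (hg : PolyOrder g a') :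
    PolyGrowth (fun p => f p / g p) (a - a') := by
  have hinv : PolyGrowth (fun p => (g p)⁻¹) (-a') := by
    intro x hx
    refine ((hg.rpow_isBigO (-x) (by linarith)).inv_rev ?_).congr_right fun p => ?_
    · filter_upwards [eventually_gt_atTop 0] with p hp h0
      exact absurd h0 (Real.rpow_pos_of_pos (Nat.cast_pos.mpr hp) _).ne'
    · rw [Real.rpow_neg (Nat.cast_nonneg p), inv_inv]
  simpa only [div_eq_mul_inv, sub_eq_add_neg] using hf.mul hinv

lemma tendsto_zero (hf : PolyGrowth f a) (ha : a < 0) : Tendsto f atTop (𝓝 0) := by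
  refine (hf (a / 2) (by linarith)).trans_tendsto ?_
  simpa [Function.comp_def] using
    (tendsto_rpow_neg_atTop (y := -(a / 2)) (by linarith)).comp
      (tendsto_natCast_atTop_atTop (R := ℝ))

lemma eventually_le (hf : PolyGrowth f a) (ha : a < 0) (hη : 0 < η) : ∀ᶠ p in atTop, f p ≤ η :=
  (hf.tendsto_zero ha).eventually_le_const hη

lemma log_comp (hf : PolyGrowth f a) (h1 : ∀ᶠ p in atTop, 1 ≤ f p) :
    PolyGrowth (fun p => Real.log (f p)) 0 := by
  obtain ⟨K, hK, hfK⟩ := (hf (a + 1) (by linarith)).exists_pos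
  refine ((const (Real.log K)).add (log_natCast.const_mul (a + 1))).of_eventually_le
    (h1.mono fun p hp => Real.log_nonneg hp) ?_
  filter_upwards [h1, hfK.bound, eventually_gt_atTop 0] with p hp hbound hp0
  rw [Real.norm_of_nonneg (by linarith), Real.norm_of_nonneg (by positivity)] at hbound
  calc Real.log (f p) ≤ Real.log (K * (p : ℝ) ^ (a + 1)) :=
        Real.log_le_log (by linarith) hbound
    _ = Real.log K + (a + 1) * Real.log p := by
        rw [Real.log_mul hK.ne' (by positivity), Real.log_rpow (Nat.cast_pos.mpr hp0)]

end PolyGrowth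

namespace PolyOrder

variable {f : ℕ → ℝ} {a : ℝ}

lemma of_isTheta_rpow (h : f =Θ[atTop] fun p : ℕ => (p : ℝ) ^ a) : PolyOrder f a where
  growth := .of_isBigO_rpow h.isBigO
  rpow_isBigO _ hx := (natCast_rpow_isBigO_natCast_rpow hx.le).trans h.isBigO_symm

lemma of_abs_sub_rpow_le (ha : 0 < a) (hf : ∀ p : ℕ, |f p - (p : ℝ) ^ a| ≤ 1) :
    PolyOrder f a := by
  have hlim : Tendsto (fun p : ℕ => (p : ℝ) ^ a) atTop atTop :=
    (tendsto_rpow_atTop ha).comp tendsto_natCast_atTop_atTop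
  have hsub : (fun p => f p - (p : ℝ) ^ a) =o[atTop] fun p : ℕ => (p : ℝ) ^ a :=
    (IsBigO.of_norm_le (g := fun _ => (1 : ℝ)) hf).trans_isLittleO
      (isLittleO_const_left.mpr (.inr (tendsto_norm_atTop_atTop.comp hlim)))
  exact of_isTheta_rpow (IsEquivalent.isTheta hsub)

lemma eventually_ne_zero (hf : PolyOrder f a) : ∀ᶠ p in atTop, f p ≠ 0 := by
  filter_upwards [(hf.rpow_isBigO (a - 1) (by linarith)).eq_zero_imp, eventually_gt_atTop 0]
    with p hzero hp h0
  exact (Real.rpow_pos_of_pos (Nat.cast_pos.mpr hp) _).ne' (hzero h0)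

lemma sqrt (hf : PolyOrder f a) (h0 : 0 ≤ f) : PolyOrder (fun p => √(f p)) (a / 2) where
  growth := hf.growth.sqrt
  rpow_isBigO x hx := by
    simpa only [sqrt_natCast_rpow_two_mul] using
      (hf.rpow_isBigO (2 * x) (by linarith)).sqrt (Eventually.of_forall h0)

end PolyOrder

lemma isLittleO_of_eventually_le_mul {f g h : ℕ → ℝ} (hh : Tendsto h atTop (𝓝 0))
    (hf : ∀ᶠ p in atTop, 0 ≤ f p) (hle : ∀ᶠ p in atTop, f p ≤ h p * g p) : f =o[atTop] g := by
  have hhg : (fun p => h p * g p) =o[atTop] g := by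
    simpa using ((isLittleO_one_iff ℝ).mpr hh).mul_isBigO (isBigO_refl g atTop)
  refine IsBigO.trans_isLittleO (IsBigO.of_norm_eventuallyLE ?_) hhg
  filter_upwards [hf, hle] with p hp0 hp
  rwa [Real.norm_of_nonneg hp0]

lemma tendsto_natCast_pow_mul_exp_neg_log_sq (m : ℕ) {K : ℝ} (hK : 0 < K) :
    Tendsto (fun p : ℕ => (p : ℝ) ^ m * Real.exp (-Real.log p ^ 2 / K)) atTop (𝓝 0) := by
  have hlog : Tendsto (fun p : ℕ => Real.log p) atTop atTop :=
    Real.tendsto_log_atTop.comp tendsto_natCast_atTop_atTop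
  have hquad : Tendsto (fun x : ℝ => x * (x / K - m)) atTop atTop :=
    tendsto_id.atTop_mul_atTop₀ (tendsto_atTop_add_const_right _ _ (tendsto_id.atTop_div_const hK))
  refine (Real.tendsto_exp_neg_atTop_nhds_zero.comp (hquad.comp hlog)).congr' ?_
  filter_upwards [eventually_gt_atTop 0] with p hp
  have hpow : (p : ℝ) ^ m = Real.exp (m * Real.log p) := by
    rw [Real.exp_nat_mul, Real.exp_log (Nat.cast_pos.mpr hp)]
  rw [hpow, ← Real.exp_add, Function.comp_apply, Function.comp_apply]
  congr 1
  ring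

end PolynomialGrowth

namespace ParamTuple

section Admissible

variable {t : ParamTuple} {c : ModelConsts} {C : ℝ}

lemma rowBound_sq :
    t.rowBound c ^ 2 = 2 * t.p * c.b ^ 2 + (c.b * √t.s₀ + c.τ) ^ 2 :=
  Real.sq_sqrt (by positivity)

lemma w_sq (hε : 0 ≤ t.ε) (hδ : 0 ≤ Real.log (4 / t.δ)) :
    t.w c ^ 2 = 4 * t.rowBound c ^ 2 / t.ε *
      (√(2 * t.r * Real.log (4 / t.δ)) + Real.log (4 / t.δ)) :=
  Real.sq_sqrt (by positivity)

lemma w_pos (hε : 0 < t.ε) (hδ : 0 < Real.log (4 / t.δ)) (hp : 0 < t.p) (hb : 0 < c.b) :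
    0 < t.w c := by
  have hrow : 0 < t.rowBound c ^ 2 := by
    rw [rowBound_sq]
    positivity
  exact Real.sqrt_pos.mpr (by positivity)

variable (t c) in
/-- The parameters lie in the regime in which the projection is no smaller than the sample and the
privacy noise is dominated by the design. -/
structure Admissible : Prop where
  one_le_log : 1 ≤ Real.log t.p
  n_pos : 0 < t.n
  r_pos : 0 < t.r
  n_le_r : t.n ≤ t.r
  w_pos : 0 < t.w c
  w_sq_le : t.w c ^ 2 ≤ t.n
  σ_pos : 0 < c.σ
  τ_pos : 0 < c.τ

variable (t c) in
/-- The common denominator of the sparsity conditions: up to logarithms, the larger of `w / √(nr)`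
and `w² / (n √r)`, the two ways in which the privacy noise enters the bias. -/
noncomputable def privacyScale : ℝ :=
  max (t.w c * Real.log t.p / √(t.n * t.r)) (t.w c ^ 2 / t.n * √(Real.log t.p / t.r))

namespace Admissible

variable (h : t.Admissible c)
include h

lemma cast_n_pos : (0 : ℝ) < t.n := Nat.cast_pos.mpr h.n_pos

lemma cast_r_pos : (0 : ℝ) < t.r := Nat.cast_pos.mpr h.r_pos

lemma cast_n_le_r : (t.n : ℝ) ≤ t.r := Nat.cast_le.mpr h.n_le_r

lemma log_pos : 0 < Real.log t.p := one_pos.trans_le h.one_le_log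

lemma sqrt_log_le : √(Real.log t.p) ≤ Real.log t.p :=
  Real.sqrt_le_self_iff.mpr (.inr h.one_le_log)

lemma w_le_sqrt_n : t.w c ≤ √t.n := Real.le_sqrt_of_sq_le h.w_sq_le

lemma w_sq_div_n_le_one : t.w c ^ 2 / t.n ≤ 1 := (div_le_one h.cast_n_pos).mpr h.w_sq_le

lemma one_le_phi : 1 ≤ t.phi c :=
  le_add_of_nonneg_right (div_nonneg (sq_nonneg _) h.cast_n_pos.le)

lemma inv_sqrt_n_le_rho : (√t.n)⁻¹ ≤ t.rho c := by
  have hn := h.cast_n_pos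
  have hr := h.cast_r_pos
  rw [← Real.sqrt_inv]
  refine Real.sqrt_le_sqrt ?_
  calc (t.n : ℝ)⁻¹ = t.r / (t.n * t.r) := by field_simp
    _ ≤ (t.n + t.r + 1) / (t.n * t.r) := by gcongr; linarith
    _ ≤ (t.n + t.r + 1) / (t.n * t.r) + t.w c ^ 2 / (t.n * t.r) :=
        le_add_of_nonneg_right (by positivity)

lemma rho_pos : 0 < t.rho c :=
  (inv_pos.mpr (Real.sqrt_pos.mpr h.cast_n_pos)).trans_le h.inv_sqrt_n_le_rho

lemma inv_mul_rho_le : 1 / (c.σ * t.rho c) ≤ √t.n / c.σ := by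
  have hσ := h.σ_pos
  have hrho : (t.rho c)⁻¹ ≤ √t.n :=
    inv_le_of_inv_le₀ (Real.sqrt_pos.mpr h.cast_n_pos) h.inv_sqrt_n_le_rho
  calc 1 / (c.σ * t.rho c) = (t.rho c)⁻¹ / c.σ := by rw [one_div, mul_inv_rev, div_eq_mul_inv]
    _ ≤ √t.n / c.σ := by gcongr

lemma le_penalty (hC : 0 ≤ C) : C * c.σ / √t.n ≤ t.penalty c C := by
  have hn := h.cast_n_pos
  have hσ := h.σ_pos
  rw [penalty, div_eq_mul_inv, ← Real.sqrt_inv]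
  refine mul_le_mul_of_nonneg_left (le_max_of_le_left (Real.sqrt_le_sqrt ?_)) (by positivity)
  rw [inv_eq_one_div]
  gcongr
  exact h.one_le_log

lemma penalty_pos (hC : 0 < C) : 0 < t.penalty c C := by
  have hn := h.cast_n_pos
  have hσ := h.σ_pos
  exact lt_of_lt_of_le (by positivity) (h.le_penalty hC.le)

lemma privacyScale_pos : 0 < t.privacyScale c := by
  have hn := h.cast_n_pos
  have hr := h.cast_r_pos
  have hw := h.w_pos
  have hlog := h.log_pos
  exact lt_max_of_lt_left (by positivity)

lemma inv_privacyScale_eq : (t.privacyScale c)⁻¹ =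
    min (t.n / t.w c ^ 2 * √(t.r / Real.log t.p)) (√(t.n * t.r) / (t.w c * Real.log t.p)) := by
  have hn := h.cast_n_pos
  have hr := h.cast_r_pos
  have hw := h.w_pos
  have hlog := h.log_pos
  rw [privacyScale, inv_antitoneOn_Ioi.map_max (Set.mem_Ioi.mpr (by positivity))
    (Set.mem_Ioi.mpr (by positivity)), min_comm, mul_inv, inv_div, inv_div, ← Real.sqrt_inv,
    inv_div]

lemma privacyScale_le : t.privacyScale c ≤ Real.log t.p / √t.n := by
  have hn := h.cast_n_pos
  have hr := h.cast_r_pos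
  have hlog := h.log_pos
  have hsqrt := Real.sqrt_le_sqrt h.cast_n_le_r
  refine max_le ?_ ?_
  · calc t.w c * Real.log t.p / √(t.n * t.r) = t.w c / √t.n * (Real.log t.p / √t.r) := by
          rw [Real.sqrt_mul hn.le, mul_div_mul_comm]
      _ ≤ 1 * (Real.log t.p / √t.n) := by
          gcongr
          exact (div_le_one (by positivity)).mpr h.w_le_sqrt_n
      _ = Real.log t.p / √t.n := one_mul _
  · calc t.w c ^ 2 / t.n * √(Real.log t.p / t.r)
        = t.w c ^ 2 / t.n * (√(Real.log t.p) / √t.r) := by rw [Real.sqrt_div hlog.le]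
      _ ≤ 1 * (Real.log t.p / √t.n) := by
          gcongr
          exacts [h.w_sq_div_n_le_one, h.sqrt_log_le]
      _ = Real.log t.p / √t.n := one_mul _

lemma sqrt_n_div_log_le {x : ℝ} (hx : t.n ≤ x) :
    √t.n / Real.log t.p ≤ √(x / Real.log t.p) := by
  have hlog := h.log_pos
  rw [Real.sqrt_div (h.cast_n_pos.le.trans hx)]
  gcongr
  exact h.sqrt_log_le

lemma sqrt_n_div_log_le_mul_min : √t.n / Real.log t.p ≤
    √(t.n / Real.log t.p) * min 1 (min √(t.r / t.n) (√(t.r * t.n) / t.w c ^ 2)) := by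
  have hn := h.cast_n_pos
  have hw := h.w_pos
  have hratio : 1 ≤ √((t.r : ℝ) / t.n) :=
    Real.one_le_sqrt.mpr ((one_le_div hn).mpr h.cast_n_le_r)
  have hnoise : 1 ≤ √(t.r * t.n) / t.w c ^ 2 := by
    refine (one_le_div (by positivity)).mpr (h.w_sq_le.trans (Real.le_sqrt_of_sq_le ?_))
    rw [sq]
    gcongr
    exact h.n_le_r
  rw [min_eq_left (le_min hratio hnoise), mul_one]
  exact h.sqrt_n_div_log_le le_rfl

lemma sqrt_n_div_log_le_min : √t.n / Real.log t.p ≤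
    min √(t.n / Real.log t.p) (min √(t.r / Real.log t.p)
      (min (t.n / t.w c ^ 2 * √(t.r / Real.log t.p))
        (√(t.n * t.r) / (t.w c * Real.log t.p)))) := by
  refine le_min (h.sqrt_n_div_log_le le_rfl) (le_min (h.sqrt_n_div_log_le h.cast_n_le_r) ?_)
  rw [← h.inv_privacyScale_eq, ← inv_div]
  exact inv_anti₀ h.privacyScale_pos h.privacyScale_le

lemma kappa_div_penalty_nonneg (hC : 0 < C) : 0 ≤ t.kappa c C / t.penalty c C := by
  have hpenalty := h.penalty_pos hC
  unfold kappa
  positivity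

lemma kappa_div_penalty_le (hC : 0 < C) :
    t.kappa c C / t.penalty c C ≤ 2 * √t.s₀ + C⁻¹ * (t.w c ^ 2 / t.n * (√t.n / c.σ)) := by
  have hn := h.cast_n_pos
  have hσ := h.σ_pos
  have hpenalty := h.penalty_pos hC
  have hinv : (t.penalty c C)⁻¹ ≤ (C * c.σ / √t.n)⁻¹ :=
    inv_anti₀ (by positivity) (h.le_penalty hC.le)
  calc t.kappa c C / t.penalty c C
      = 2 * √t.s₀ + t.w c ^ 2 / t.n * (t.penalty c C)⁻¹ := by
        rw [kappa]
        field_simp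
    _ ≤ 2 * √t.s₀ + t.w c ^ 2 / t.n * (C * c.σ / √t.n)⁻¹ := by gcongr
    _ = 2 * √t.s₀ + C⁻¹ * (t.w c ^ 2 / t.n * (√t.n / c.σ)) := by
        rw [inv_div]
        ring

lemma kappa_sq_div_le (hC : 0 < C) :
    t.kappa c C ^ 2 / (t.penalty c C ^ 2 * t.phi c) ≤
      (t.kappa c C / t.penalty c C) ^ 2 * (Real.log t.p / √t.n) *
        (√(t.n / Real.log t.p) * min 1 (min √(t.r / t.n) (√(t.r * t.n) / t.w c ^ 2))) := by
  have hn := h.cast_n_pos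
  have hlog := h.log_pos
  have hpenalty := h.penalty_pos hC
  calc t.kappa c C ^ 2 / (t.penalty c C ^ 2 * t.phi c)
      ≤ t.kappa c C ^ 2 / t.penalty c C ^ 2 := by
        gcongr
        exact le_mul_of_one_le_right (sq_nonneg _) h.one_le_phi
    _ = (t.kappa c C / t.penalty c C) ^ 2 * (Real.log t.p / √t.n) * (√t.n / Real.log t.p) := by
        field_simp
    _ ≤ _ := mul_le_mul_of_nonneg_left h.sqrt_n_div_log_le_mul_min (by positivity)

lemma sqrt_s₀_le (hs : √t.s₀ * √t.n * t.privacyScale c ≤ 1) :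
    √t.s₀ ≤ max (1 / √t.n) (Real.log t.p / √t.r) / t.privacyScale c := by
  rw [le_div_iff₀ h.privacyScale_pos]
  refine le_max_of_le_left ?_
  rw [le_div_iff₀ (Real.sqrt_pos.mpr h.cast_n_pos)]
  linarith

lemma sqrt_s₀_div_le : 1 / (c.σ * t.rho c) * √t.s₀ ≤
    √t.s₀ * √t.n * t.privacyScale c / c.σ *
      min (t.n / t.w c ^ 2 * √(t.r / Real.log t.p)) (√(t.n * t.r) / (t.w c * Real.log t.p)) := by
  have hσ := h.σ_pos
  have hscale := h.privacyScale_pos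
  rw [← h.inv_privacyScale_eq]
  calc 1 / (c.σ * t.rho c) * √t.s₀ ≤ √t.n / c.σ * √t.s₀ :=
        mul_le_mul_of_nonneg_right h.inv_mul_rho_le (Real.sqrt_nonneg _)
    _ = √t.s₀ * √t.n * t.privacyScale c / c.σ * (t.privacyScale c)⁻¹ := by field_simp

lemma kappa_sq_div_mul_rho_le (hC : 0 < C) :
    1 / (c.σ * t.rho c) * (4 * t.kappa c C ^ 2 / (t.penalty c C * t.phi c)) ≤
      √t.n / c.σ * (4 * ((t.kappa c C / t.penalty c C) ^ 2 * t.penalty c C)) *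
        (Real.log t.p / √t.n) *
        min √(t.n / Real.log t.p) (min √(t.r / Real.log t.p)
          (min (t.n / t.w c ^ 2 * √(t.r / Real.log t.p))
            (√(t.n * t.r) / (t.w c * Real.log t.p)))) := by
  have hn := h.cast_n_pos
  have hlog := h.log_pos
  have hσ := h.σ_pos
  have hpenalty := h.penalty_pos hC
  have hphi : 0 < t.phi c := one_pos.trans_le h.one_le_phi
  calc 1 / (c.σ * t.rho c) * (4 * t.kappa c C ^ 2 / (t.penalty c C * t.phi c))
      ≤ √t.n / c.σ * (4 * t.kappa c C ^ 2 / t.penalty c C) := by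
        refine mul_le_mul h.inv_mul_rho_le ?_ (by positivity) (by positivity)
        gcongr
        exact le_mul_of_one_le_right hpenalty.le h.one_le_phi
    _ = √t.n / c.σ * (4 * ((t.kappa c C / t.penalty c C) ^ 2 * t.penalty c C)) *
          (Real.log t.p / √t.n) * (√t.n / Real.log t.p) := by
        field_simp
    _ ≤ _ := mul_le_mul_of_nonneg_left h.sqrt_n_div_log_le_min (by positivity)

end Admissible

end Admissible

end ParamTuple

/-- A sequence of models in which the sample size, the projection size and the privacy budget are of
order `p ^ α`, `p ^ β` and `p ^ γ`, and the noise level is of order one. The inequalities between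
the exponents are those under which the private Lasso is asymptotically debiased. -/
structure PolyRegime (α β γ b : ℝ) (t : ℕ → ParamTuple) (c : ℕ → ModelConsts) : Prop where
  p_eq : ∀ k, (t k).p = k
  b_eq : ∀ k, (c k).b = b
  b_pos : 0 < b
  two_lt : 2 < α
  lt_β : α < β
  four_sub_lt : 4 - 2 * γ < β
  β_lt : β < 3 * α / 2 + 2 * γ - 2
  n_order : PolyOrder (fun k => ((t k).n : ℝ)) α
  r_order : PolyOrder (fun k => ((t k).r : ℝ)) β
  ε_order : PolyOrder (fun k => (t k).ε) γ
  ε_pos : ∀ᶠ k in atTop, 0 < (t k).ε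
  s₀_growth : PolyGrowth (fun k => ((t k).s₀ : ℝ)) 1
  δ_mem : ∀ k, (t k).δ ∈ Set.Ioo 0 1
  δ_growth : PolyGrowth (fun k => Real.log (1 / (t k).δ)) 0
  σ_pos : ∀ k, 0 < (c k).σ
  σ_order : PolyOrder (fun k => (c k).σ) 0
  τ_growth : PolyGrowth (fun k => (c k).τ) 0
  τ_pos : ∀ᶠ k in atTop, 0 < (c k).τ

namespace PolyRegime

variable {α β γ b C : ℝ} {t : ℕ → ParamTuple} {c : ℕ → ModelConsts}
variable (h : PolyRegime α β γ b t c)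
include h

lemma p_growth : PolyGrowth (fun k => ((t k).p : ℝ)) 1 := by
  simpa only [h.p_eq] using PolyGrowth.natCast

lemma log_p_growth : PolyGrowth (fun k => Real.log (t k).p) 0 := by
  simpa only [h.p_eq] using PolyGrowth.log_natCast

lemma sqrt_n_order : PolyOrder (fun k => √(t k).n) (α / 2) :=
  h.n_order.sqrt fun _ => Nat.cast_nonneg _

lemma sqrt_r_order : PolyOrder (fun k => √(t k).r) (β / 2) :=
  h.r_order.sqrt fun _ => Nat.cast_nonneg _

lemma log_div_sqrt_n_growth : PolyGrowth (fun k => Real.log (t k).p / √(t k).n) (-(α / 2)) :=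
  (h.log_p_growth.div h.sqrt_n_order).mono (by linarith)

lemma log_div_sqrt_r_growth : PolyGrowth (fun k => Real.log (t k).p / √(t k).r) (-(β / 2)) :=
  (h.log_p_growth.div h.sqrt_r_order).mono (by linarith)

lemma log_four_div_δ_pos (k : ℕ) : 0 < Real.log (4 / (t k).δ) := by
  obtain ⟨hδ0, hδ1⟩ := h.δ_mem k
  exact Real.log_pos ((one_lt_div hδ0).mpr (by linarith))

lemma log_four_div_δ_growth : PolyGrowth (fun k => Real.log (4 / (t k).δ)) 0 := by
  have hsplit (k : ℕ) : Real.log (4 / (t k).δ) = Real.log 4 + Real.log (1 / (t k).δ) := by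
    rw [← Real.log_mul (by norm_num) (one_div_pos.mpr (h.δ_mem k).1).ne', mul_one_div]
  simpa only [hsplit] using (PolyGrowth.const (Real.log 4)).add h.δ_growth

lemma rowBound_sq_growth : PolyGrowth (fun k => (t k).rowBound (c k) ^ 2) 1 := by
  have hdesign : PolyGrowth (fun k => 2 * ((t k).p : ℝ) * b ^ 2) 1 :=
    ((h.p_growth.const_mul 2).mul (PolyGrowth.const (b ^ 2))).mono (by norm_num)
  have hresponse : PolyGrowth (fun k => (b * √(t k).s₀ + (c k).τ) ^ 2) 1 :=
    ((h.s₀_growth.sqrt.const_mul b).add (h.τ_growth.mono (by norm_num))).sq.mono (by norm_num)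
  simpa only [ParamTuple.rowBound_sq, h.b_eq] using hdesign.add hresponse

lemma w_sq_growth : PolyGrowth (fun k => (t k).w (c k) ^ 2) (1 - γ + β / 2) := by
  have hprojection : PolyGrowth (fun k => √(2 * (t k).r * Real.log (4 / (t k).δ)) +
      Real.log (4 / (t k).δ)) (β / 2) :=
    (((h.r_order.growth.const_mul 2).mul h.log_four_div_δ_growth).sqrt.mono (by linarith)).add
      (h.log_four_div_δ_growth.mono (by linarith [h.two_lt, h.lt_β]))
  refine (((h.rowBound_sq_growth.const_mul 4).div h.ε_order).mul hprojection).of_eventually_le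
    (Eventually.of_forall fun _ => sq_nonneg _) ?_
  filter_upwards [h.ε_pos] with k hε
  exact (ParamTuple.w_sq hε.le (h.log_four_div_δ_pos k).le).le

lemma w_growth : PolyGrowth (fun k => (t k).w (c k)) ((1 - γ + β / 2) / 2) := by
  simpa only [Real.sqrt_sq (ParamTuple.w_nonneg _)] using h.w_sq_growth.sqrt

lemma w_sq_div_n_growth :
    PolyGrowth (fun k => (t k).w (c k) ^ 2 / (t k).n) (1 - γ + β / 2 - α) :=
  h.w_sq_growth.div h.n_order

lemma admissible : ∀ᶠ k in atTop, (t k).Admissible (c k) := by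
  have hlog : Tendsto (fun p : ℕ => Real.log p) atTop atTop :=
    Real.tendsto_log_atTop.comp tendsto_natCast_atTop_atTop
  have hnr := (h.n_order.growth.div h.r_order).eventually_le (by linarith [h.lt_β]) one_pos
  have hw := h.w_sq_div_n_growth.eventually_le (by linarith [h.β_lt, h.two_lt]) one_pos
  filter_upwards [hlog.eventually_ge_atTop 1, h.n_order.eventually_ne_zero,
    h.r_order.eventually_ne_zero, hnr, hw, h.τ_pos, h.ε_pos, eventually_gt_atTop 0]
    with k hlog hn hr hnr hw hτ hε hk
  rw [← h.p_eq k] at hlog hk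
  have hn_pos : 0 < (t k).n := Nat.pos_of_ne_zero (Nat.cast_ne_zero.mp hn)
  have hr_pos : 0 < (t k).r := Nat.pos_of_ne_zero (Nat.cast_ne_zero.mp hr)
  exact
    { one_le_log := hlog
      n_pos := hn_pos
      r_pos := hr_pos
      n_le_r := Nat.cast_le.mp ((div_le_one (Nat.cast_pos.mpr hr_pos)).mp hnr)
      w_pos := ParamTuple.w_pos hε (h.log_four_div_δ_pos k) hk (h.b_eq k ▸ h.b_pos)
      w_sq_le := (div_le_one (Nat.cast_pos.mpr hn_pos)).mp hw
      σ_pos := h.σ_pos k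
      τ_pos := hτ }

lemma penalty_growth : PolyGrowth (fun k => (t k).penalty (c k) C) (-(α / 2)) := by
  have hsample := (h.log_p_growth.div h.n_order).sqrt.mono (by linarith : _ ≤ -(α / 2))
  have hlog : PolyGrowth (fun k => Real.log (t k).p ^ 3) 0 := by
    simpa only [pow_succ, pow_zero, one_mul, add_zero] using
      (h.log_p_growth.mul h.log_p_growth).mul h.log_p_growth
  have hprojection := (hlog.div h.r_order).sqrt.mono (by linarith [h.lt_β] : _ ≤ -(α / 2))
  exact ((h.σ_order.growth.const_mul C).mul (hsample.max hprojection)).mono (by linarith)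

lemma kappa_div_penalty_growth (hC : 0 < C) :
    PolyGrowth (fun k => (t k).kappa (c k) C / (t k).penalty (c k) C)
      (max (1 / 2) (1 - γ + β / 2 - α / 2)) := by
  have hsparsity := (h.s₀_growth.sqrt.const_mul 2).mono
    (le_max_left (1 / 2) (1 - γ + β / 2 - α / 2))
  have hprivacy := ((h.w_sq_div_n_growth.mul
    (h.sqrt_n_order.growth.div h.σ_order)).const_mul C⁻¹).mono
      (le_max_of_le_right (by linarith) : _ ≤ max (1 / 2) (1 - γ + β / 2 - α / 2))
  exact (hsparsity.add hprivacy).of_eventually_le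
    (h.admissible.mono fun k hk => hk.kappa_div_penalty_nonneg hC)
    (h.admissible.mono fun k hk => hk.kappa_div_penalty_le hC)

lemma kappa_div_penalty_sq_growth (hC : 0 < C) :
    ∃ x < α / 2, PolyGrowth (fun k => ((t k).kappa (c k) C / (t k).penalty (c k) C) ^ 2) x := by
  refine ⟨_, ?_, (h.kappa_div_penalty_growth hC).sq⟩
  have : max (1 / 2) (1 - γ + β / 2 - α / 2) < α / 4 :=
    max_lt (by linarith [h.two_lt]) (by linarith [h.β_lt])
  linarith

lemma sqrt_mul_privacyScale_growth :
    PolyGrowth (fun k => √(t k).s₀ * √(t k).n * (t k).privacyScale (c k))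
      (max ((2 - γ - β / 2) / 2) (3 / 2 - γ - α / 2)) := by
  have hcross : PolyGrowth (fun k => (t k).w (c k) * Real.log (t k).p / √((t k).n * (t k).r))
      ((1 - γ + β / 2) / 2 - α / 2 + -(β / 2)) := by
    simpa only [Real.sqrt_mul (Nat.cast_nonneg _), mul_div_mul_comm] using
      (h.w_growth.div h.sqrt_n_order).mul h.log_div_sqrt_r_growth
  have hsquare := h.w_sq_div_n_growth.mul (h.log_p_growth.div h.r_order).sqrt
  have hprefactor := h.s₀_growth.sqrt.mul h.sqrt_n_order.growth
  simp only [ParamTuple.privacyScale, mul_max_of_nonneg _ _ (by positivity : 0 ≤ √_ * √_)]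
  exact ((hprefactor.mul hcross).mono (le_max_of_le_left (by linarith))).max
    ((hprefactor.mul hsquare).mono (le_max_of_le_right (by linarith)))

lemma sqrt_mul_privacyScale_exponent_neg :
    max ((2 - γ - β / 2) / 2) (3 / 2 - γ - α / 2) < 0 :=
  max_lt (by linarith [h.four_sub_lt]) (by linarith [h.two_lt, h.lt_β, h.β_lt])

lemma sufficientConditions (hC : 0 < C) : SufficientConditions C t c := by
  obtain ⟨x, hx, hκ⟩ := h.kappa_div_penalty_sq_growth hC
  have hscale := h.sqrt_mul_privacyScale_growth
  have hscale_neg := h.sqrt_mul_privacyScale_exponent_neg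
  refine ⟨?_, ?_, ?_, ?_⟩
  · refine isLittleO_of_eventually_le_mul
      ((hκ.mul h.log_div_sqrt_n_growth).tendsto_zero (by linarith)) ?_
      (h.admissible.mono fun k hk => hk.kappa_sq_div_le hC)
    filter_upwards [h.admissible] with k hk
    have := hk.one_le_phi
    positivity
  · refine IsBigO.of_norm_eventuallyLE ?_
    filter_upwards [h.admissible, hscale.eventually_le hscale_neg one_pos] with k hk hle
    rw [Real.norm_of_nonneg (Real.sqrt_nonneg _)]
    exact hk.sqrt_s₀_le hle
  · refine isLittleO_of_eventually_le_mul
      ((hscale.div h.σ_order).tendsto_zero (by linarith)) ?_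
      (h.admissible.mono fun k hk => hk.sqrt_s₀_div_le)
    filter_upwards [h.admissible] with k hk
    have := hk.rho_pos
    have := hk.σ_pos
    positivity
  · refine isLittleO_of_eventually_le_mul
      ((((h.sqrt_n_order.growth.div h.σ_order).mul ((hκ.mul h.penalty_growth).const_mul 4)).mul
        h.log_div_sqrt_n_growth).tendsto_zero (by linarith)) ?_
      (h.admissible.mono fun k hk => hk.kappa_sq_div_mul_rho_le hC)
    filter_upwards [h.admissible] with k hk
    have := hk.rho_pos
    have := hk.σ_pos
    have := hk.one_le_phi
    have := hk.penalty_pos hC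
    positivity

lemma gramBound_growth :
    PolyGrowth (fun k => (t k).gramBound (c k) (Real.log (t k).p)) (-(α / 2)) := by
  simpa only [ParamTuple.gramBound, h.b_eq] using h.log_div_sqrt_n_growth.add
    ((h.log_div_sqrt_r_growth.mul (PolyGrowth.const (b ^ 2 + 1))).mono (by linarith [h.lt_β]))

lemma shiftBound_growth :
    PolyGrowth (fun k => (t k).shiftBound (c k) (Real.log (t k).p)) (-(5 * α / 8)) := by
  simpa only [ParamTuple.shiftBound, h.b_eq] using
    (((h.log_div_sqrt_r_growth.mul (PolyGrowth.const √(b ^ 2 + 1))).mul (PolyGrowth.const √2)).mul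
      (h.w_growth.div h.sqrt_n_order)).mono (by linarith [h.lt_β, h.β_lt])

lemma noiseBound_growth :
    PolyGrowth (fun k => (t k).noiseBound (c k) (Real.log (t k).p)) (-(α / 2)) := by
  simpa only [ParamTuple.noiseBound, h.b_eq] using
    ((h.log_div_sqrt_n_growth.mul h.τ_growth).mono (by linarith)).add
      (((h.log_div_sqrt_r_growth.mul (PolyGrowth.const √(b ^ 2 + 1))).mul h.τ_growth).mono
        (by linarith [h.lt_β]))

lemma l1Bound_growth :
    PolyGrowth (fun k => (t k).l1Bound (c k) C (Real.log (t k).p)) (1 / 2 - α / 4) := by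
  have hscore := h.penalty_growth (C := C) |>.add
    (h.noiseBound_growth.add (h.shiftBound_growth.mono (by linarith [h.two_lt])))
  have hridge := h.p_growth.sqrt.mul h.w_sq_div_n_growth
  exact (((h.p_growth.mul hscore).mono (by linarith [h.two_lt])).add
    (hridge.mono (by linarith [h.β_lt]))).const_mul 4

lemma biasBound_growth :
    PolyGrowth (fun k => (t k).biasBound (c k) C (Real.log (t k).p))
      (max (1 / 2 - 3 * α / 4) (-(5 * α / 8))) :=
  ((h.gramBound_growth.mul h.l1Bound_growth).mono (le_max_of_le_left (by linarith))).add
    (h.shiftBound_growth.mono (le_max_right _ _))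

lemma eventually_norm_bias_div_le (hC : 0 < C) {θ₀ : (k : ℕ) → Fin (t k).p → ℝ}
    (hθ₀ : ∀ᶠ k in atTop, θ₀ k ⬝ᵥ θ₀ k ≤ 1) {η : ℝ} (hη : 0 < η) :
    ∀ᶠ k in atTop, ∀ (ω : (t k).Sample) (θ : Fin (t k).p → ℝ),
      ω.Regular (c k) (θ₀ k) (Real.log (t k).p) → ω.IsLasso (c k) (θ₀ k) C θ →
        ‖ω.bias (c k) (θ₀ k) θ‖ / ((c k).σ * (t k).rho (c k)) ≤ η := by
  have hexponent : max (1 / 2 - 3 * α / 4) (-(5 * α / 8)) < -(α / 2) :=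
    max_lt (by linarith [h.two_lt]) (by linarith [h.two_lt])
  have hbias := ((h.sqrt_n_order.growth.div h.σ_order).mul
    (h.biasBound_growth (C := C))).eventually_le (by linarith) hη
  have hgram := (h.p_growth.mul h.gramBound_growth).eventually_le (by linarith [h.two_lt])
    one_half_pos
  filter_upwards [hbias, hgram, h.admissible, hθ₀] with k hbias hgram hk hθ₀ ω θ hω hθ
  have hσ := hk.σ_pos
  calc ‖ω.bias (c k) (θ₀ k) θ‖ / ((c k).σ * (t k).rho (c k))
      = 1 / ((c k).σ * (t k).rho (c k)) * ‖ω.bias (c k) (θ₀ k) θ‖ := by ring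
    _ ≤ √(t k).n / (c k).σ * (t k).biasBound (c k) C (Real.log (t k).p) :=
        mul_le_mul hk.inv_mul_rho_le (hω.norm_bias_le_biasBound hθ (hk.penalty_pos hC).le hk.n_pos
          hk.log_pos.le hk.τ_pos.le hk.w_sq_le hθ₀ hgram) (norm_nonneg _) (by positivity)
    _ ≤ η := hbias

lemma debiasingProperty (hC : 0 < C) {D : Measure ℝ} (hD : IsDesignLaw D b)
    {θ₀ : (k : ℕ) → Fin (t k).p → ℝ} (hθ₀ : ∀ᶠ k in atTop, θ₀ k ⬝ᵥ θ₀ k ≤ 1) :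
    DebiasingProperty C t c D θ₀ := by
  intro η hη
  have hlim : Tendsto (fun k => ENNReal.ofReal (20 * ((t k).p : ℝ) ^ 2 *
      Real.exp (-Real.log (t k).p ^ 2 / (16 * (b ^ 2 + 1) ^ 2)))) atTop (𝓝 0) := by
    simpa [h.p_eq, mul_assoc] using ENNReal.tendsto_ofReal
      ((tendsto_natCast_pow_mul_exp_neg_log_sq 2
        (by positivity : 0 < 16 * (b ^ 2 + 1) ^ 2)).const_mul 20)
  have hlog := h.log_div_sqrt_r_growth.eventually_le (by linarith [h.two_lt, h.lt_β]) one_pos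
  refine tendsto_of_tendsto_of_tendsto_of_le_of_le' tendsto_const_nhds hlim
    (Eventually.of_forall fun _ => zero_le) ?_
  filter_upwards [h.admissible, h.eventually_norm_bias_div_le hC hθ₀ hη, hlog]
    with k hk hbias hlog
  have := hD.1
  have := isProbabilityMeasure_truncatedGaussian hk.σ_pos.ne' hk.τ_pos
  have hregular := ParamTuple.sampleLaw_not_regular_le ((h.b_eq k).symm ▸ hD) hk.σ_pos hk.τ_pos
    hk.n_pos hk.r_pos hk.log_pos.le ((div_le_one (Real.sqrt_pos.mpr hk.cast_r_pos)).mp hlog) (θ₀ k)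
  rw [h.b_eq] at hregular
  refine (measure_mono ?_).trans
    ((ENNReal.le_ofReal_iff_toReal_le (measure_ne_top _ _) (by positivity)).mpr hregular)
  rintro ω ⟨θ, hθ, hlt⟩ hω
  exact (hbias ω θ hω hθ).not_gt hlt

end PolyRegime

theorem mainTheorem7_general {C α γ : ℝ} {n s₀ : ℕ → ℕ} {ε δ : ℕ → ℝ} (hC : 0 < C) (hα : 2 < α)
    (hαγ : 4 < α + 4 * γ) (hαγ' : 12 < 3 * α + 8 * γ) (hn : PolyOrder (fun p => (n p : ℝ)) α)
    (hε : PolyOrder ε γ) (hε_pos : ∀ᶠ p in atTop, 0 < ε p) (hδ : ∀ p, δ p ∈ Set.Ioo 0 1)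
    (hδ_log : PolyGrowth (fun p => Real.log (1 / δ p)) 0) :
    ∃ r : ℕ → ℕ, Tendsto r atTop atTop ∧
      ∀ (D : Measure ℝ) (b : ℝ) (σ τ : ℕ → ℝ) (θ₀ : (p : ℕ) → Fin p → ℝ),
        IsDesignLaw D b → (∀ p, 0 < σ p) → PolyOrder σ 0 → PolyGrowth τ 0 →
        (∀ᶠ p in atTop, 0 < τ p) →
        (∀ᶠ p in atTop, ∑ j, θ₀ p j ^ 2 = 1 ∧ (Function.support (θ₀ p)).ncard = s₀ p) →
        SufficientConditions C (fun p => ⟨n p, p, s₀ p, r p, ε p, δ p⟩)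
            (fun p => ⟨b, σ p, τ p⟩) ∧
          DebiasingProperty C (fun p => ⟨n p, p, s₀ p, r p, ε p, δ p⟩)
            (fun p => ⟨b, σ p, τ p⟩) D θ₀ := by
  obtain ⟨β, hβ, hβ_lt⟩ : ∃ β, max α (4 - 2 * γ) < β ∧ β < 3 * α / 2 + 2 * γ - 2 :=
    exists_between (max_lt (by linarith) (by linarith))
  obtain ⟨hαβ, hγβ⟩ := max_lt_iff.mp hβ
  have hβ_pos : 0 < β := by linarith
  refine ⟨fun p => ⌈(p : ℝ) ^ β⌉₊, tendsto_nat_ceil_atTop.comp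
    ((tendsto_rpow_atTop hβ_pos).comp tendsto_natCast_atTop_atTop), ?_⟩
  intro D b σ τ θ₀ hD hσ hσ_order hτ hτ_pos hθ₀
  have hs₀ : PolyGrowth (fun p => (s₀ p : ℝ)) 1 := by
    refine PolyGrowth.natCast.of_eventually_le (.of_forall fun _ => Nat.cast_nonneg _) ?_
    filter_upwards [hθ₀] with p hp
    rw [← hp.2]
    exact_mod_cast (Set.ncard_le_card _).trans_eq (Nat.card_fin p)
  have h : PolyRegime α β γ b (fun p => ⟨n p, p, s₀ p, ⌈(p : ℝ) ^ β⌉₊, ε p, δ p⟩)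
      (fun p => ⟨b, σ p, τ p⟩) :=
    { p_eq := fun _ => rfl
      b_eq := fun _ => rfl
      b_pos := hD.pos
      two_lt := hα
      lt_β := hαβ
      four_sub_lt := hγβ
      β_lt := hβ_lt
      n_order := hn
      r_order := .of_abs_sub_rpow_le hβ_pos fun p =>
        Nat.abs_ceil_sub_le (Real.rpow_nonneg (Nat.cast_nonneg p) β)
      ε_order := hε
      ε_pos := hε_pos
      s₀_growth := hs₀
      δ_mem := hδ
      δ_growth := hδ_log
      σ_pos := hσ
      σ_order := hσ_order
      τ_growth := hτ
      τ_pos := hτ_pos }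
  exact ⟨h.sufficientConditions hC, h.debiasingProperty hC hD
    (hθ₀.mono fun p hp => by simpa only [dotProduct, sq] using hp.1.le)⟩

theorem mainTheorem7 :
    ∃ C : ℝ, 0 < C ∧
      ∀ (α γ c₀ : ℝ) (n s₀ : ℕ → ℕ) (δ : ℕ → ℝ),
        2 < α → 3 / 4 < γ → 0 < c₀ → c₀ < 1 →
        (∀ p : ℕ, |(n p : ℝ) - (p : ℝ) ^ α| ≤ 1) →
        (∀ p : ℕ, |(s₀ p : ℝ) - c₀ * p| ≤ 1) →
        (∀ p : ℕ, 0 < δ p ∧ δ p < 1) →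
        ((fun p : ℕ => Real.log (1 / δ p)) =O[atTop] fun p : ℕ => Real.log p) →
        ∃ r : ℕ → ℕ, Tendsto r atTop atTop ∧
          ∀ (D : Measure ℝ) (b : ℝ) (σ τ : ℕ → ℝ) (θ₀ : (p : ℕ) → Fin p → ℝ),
            IsDesignLaw D b →
            (∀ p, 0 < σ p) → (σ =Θ[atTop] fun _ : ℕ => (1 : ℝ)) →
            (τ =O[atTop] fun p : ℕ => σ p * Real.sqrt (Real.log (n p))) →
            Tendsto (fun p : ℕ => τ p / σ p - Real.sqrt (2 * Real.log (2 * n p))) atTop atTop →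
            (∀ᶠ p in atTop, ∑ j, θ₀ p j ^ 2 = 1 ∧ (Function.support (θ₀ p)).ncard = s₀ p) →
            SufficientConditions C (fun p => ⟨n p, p, s₀ p, r p, (p : ℝ) ^ γ, δ p⟩)
                (fun p => ⟨b, σ p, τ p⟩) ∧
              DebiasingProperty C (fun p => ⟨n p, p, s₀ p, r p, (p : ℝ) ^ γ, δ p⟩)
                (fun p => ⟨b, σ p, τ p⟩) D θ₀ := by
  refine ⟨1, one_pos, fun α γ c₀ n s₀ δ hα hγ _ _ hn _ hδ hδ_log => ?_⟩
  have hn_order : PolyOrder (fun p => (n p : ℝ)) α := .of_abs_sub_rpow_le (by linarith) hn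
  obtain ⟨r, hr, hdebias⟩ := mainTheorem7_general (s₀ := s₀) one_pos hα (by linarith)
    (by linarith) hn_order (.of_isTheta_rpow (isTheta_refl _ _))
    ((eventually_gt_atTop 0).mono fun p hp => Real.rpow_pos_of_pos (Nat.cast_pos.mpr hp) γ)
    hδ (PolyGrowth.log_natCast.of_isBigO hδ_log)
  refine ⟨r, hr, fun D b σ τ θ₀ hD hσ hσ_theta hτ hτ_tendsto hθ₀ => ?_⟩
  have hσ_order : PolyOrder σ 0 := .of_isTheta_rpow (by simpa using hσ_theta)
  have hlog : PolyGrowth (fun p => Real.log (n p)) 0 := hn_order.growth.log_comp <|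
    hn_order.eventually_ne_zero.mono fun p hp =>
      Nat.one_le_cast.mpr (Nat.one_le_iff_ne_zero.mpr (Nat.cast_ne_zero.mp hp))
  have hτ_pos : ∀ᶠ p in atTop, 0 < τ p := by
    filter_upwards [hτ_tendsto.eventually_gt_atTop 0] with p hp
    exact (div_pos_iff_of_pos_right (hσ p)).mp
      ((Real.sqrt_nonneg _).trans_lt (sub_pos.mp hp))
  exact hdebias D b σ τ θ₀ hD hσ hσ_order
    (.of_isBigO hτ ((hσ_order.growth.mul hlog.sqrt).mono (by norm_num))) hτ_pos hθ₀
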